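/- **Setting.** Let $G=(V,E,w)$ be a finite weighted undirected graph (parallel edges allowed) with $n=|V|\ge 3$ and weights $w_e\ge 0$, and let $s,t\in V$ be connected in $G$. Let $\beta\ge 0$, $\rho\ge 1$, let $\lambda_1,\dots,\lambda_m\ge 0$, and let $\lambda_i^e\ge 0$ ($i\in[m]$, $e\in E$) be known dependence parameters. The hidden demands $y_1,\dots,y_m$ are independent, and $y_i$ has a known law $\mathcal D_i$ on $[\lambda_i,\rho\lambda_i]$. The actual graph $G'$ has edge weights $w'_e(y)=\big(\sum_{i=1}^m\lambda_i^e y_i\big)^{\beta}w_e$; let $\delta$ be the $s$–$t$ distance in $G'$. The weights under basic demands are $\tilde w_e=\big(\sum_i\lambda_i^e\lambda_i\big)^{\beta}w_e$ and $\tilde G=(V,E,\tilde w)$. The cluster of demand $i$ is $C_i=\{e\in E:\lambda_i^e>0\}$. The *highway dimension* of a weighted graph is the smallest integer $h$ such that for all $r>0$ and all vertices $u$ there is a set $S$ of at most $h$ vertices of the closed ball $B_u(4r)$ which meets every shortest path of length $>r$ all of whose vertices lie in $B_u(4r)$. The *continuous highway dimension* is the limit, as $k\to\infty$, of the highway dimensions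 of the graphs obtained by replacing each edge with a path of $k$ edges, each having $1/k$ of the original weight. **Algorithm** (for $0<\varepsilon\le 1$ and an integer $\ell\ge 1$). Let $L$ be the $s$–$t$ distance in $\tilde G$, let $H$ be the subgraph induced by the vertices at distance at most $\rho^{\beta}L$ from $s$ in $\tilde G$, and let $\Omega_i=\sum_{e\in E_H\cap C_i}\tilde w_e$. For each $i\in[m]$: if $\Omega_i>\varepsilon^2L/(16\,\ln(2n)\,\rho^{3\beta}\,\ell)$, probe $y_i$ and set $y'_i=y_i$; otherwise draw a fresh independent sample $y'_i\sim\mathcal D_i$. Return the $s$–$t$ distance $\hat\delta$ in $H$ with edge weights $\big(\sum_i\lambda_i^ey'_i\big)^{\beta}w_e$. **Theorem.** There is an absolute constant $C>0$ such that the following holds in this setting. Suppose that 1. $\tilde G$ has continuous highway dimension $h$; 2. every $C_i$ is the edge set of a shortest path of $\tilde G$; 3. every edge lies in at most $\ell$ of the clusters $C_1,\dots,C_m$. Then the algorithm probes at most $\left(\dfrac{\ln n\cdot\rho^{\beta}\cdot\ell}{\varepsilon^2}\right)^{C\ln h}$ demands, where the power is read as $1$ if $h=0$, and with probability at least $1-1/n$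 over the demands and its own samples it returns a $(1+\varepsilon)$-approximation of the distance: $|\hat\delta-\delta|\le\varepsilon\,\delta$. -/

import Mathlib

open Filter Topology MeasureTheory
open scoped Graph

noncomputable section

/-! ### Weighted undirected (multi)graphs: walks, distances, balls, shortest paths

Graphs are Mathlib's undirected multigraphs `Graph α β`, with vertex set `V(G)` and edge set
`E(G)`; edge weights are functions `w : β → ℝ`. -/

/-- Walks from one vertex to another in `G`. -/
inductive Graph.Walk {α β : Type*} (G : Graph α β) : α → α → Type _
  | nil {u : α} (hu : u ∈ V(G)) : Graph.Walk G u u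
  | cons {u v x : α} (e : β) (he : G.IsLink e u v) (p : Graph.Walk G v x) : Graph.Walk G u x

namespace Graph

variable {α β : Type*} {G : Graph α β}

/-- The vertices of a walk, in order. -/
def Walk.vertices : {u v : α} → G.Walk u v → List α
  | u, _, .nil _ => [u]
  | u, _, .cons _ _ p => u :: p.vertices

/-- The edges of a walk, in order. -/
def Walk.edges : {u v : α} → G.Walk u v → List β
  | _, _, .nil _ => []
  | _, _, .cons e _ p => e :: p.edges

/-- The total weight of a walk. -/
def Walk.length (w : β → ℝ) {u v : α} (p : G.Walk u v) : ℝ := (p.edges.map w).sum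

/-- `p` is a shortest path between its ends: it repeats no vertex, and no walk with the same ends
is shorter. -/
def Walk.IsShortestPath (w : β → ℝ) {u v : α} (p : G.Walk u v) : Prop :=
  p.vertices.Nodup ∧ ∀ q : G.Walk u v, p.length w ≤ q.length w

/-- `u` and `v` are vertices joined by a walk. -/
def Reachable (G : Graph α β) (u v : α) : Prop := Nonempty (G.Walk u v)

/-- The shortest path distance (meaningful when `v` is reachable from `u`). -/
def wdist (G : Graph α β) (w : β → ℝ) (u v : α) : ℝ := ⨅ p : G.Walk u v, p.length w

/-- The closed ball `{v | d(u, v) ≤ r}`; vertices that cannot be reached are at infinite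
distance. -/
def wball (G : Graph α β) (w : β → ℝ) (u : α) (r : ℝ) : Set α :=
  {v | G.Reachable u v ∧ G.wdist w u v ≤ r}

/-- The edge set `C` is the edge set of some shortest path. -/
def IsShortestPathEdgeSet (G : Graph α β) (w : β → ℝ) (C : Set β) : Prop :=
  ∃ (u v : α) (p : G.Walk u v), p.IsShortestPath w ∧ {e | e ∈ p.edges} = C

/-! ### Highway dimension and continuous highway dimension -/

/-- For every ball of radius `4 r`, some set of at most `h` vertices of the ball meets every
shortest path of length more than `r` inside the ball. -/
def HighwayBound (G : Graph α β) (w : β → ℝ) (h : ℕ) : Prop :=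
  ∀ r : ℝ, 0 < r → ∀ u ∈ V(G), ∃ S : Finset α, (S : Set α) ⊆ G.wball w u (4 * r) ∧ S.card ≤ h ∧
    ∀ v ∈ G.wball w u (4 * r), ∀ v' ∈ G.wball w u (4 * r), ∀ p : G.Walk v v',
      p.IsShortestPath w → r < p.length w → (∀ x ∈ p.vertices, x ∈ G.wball w u (4 * r)) →
        ∃ x ∈ p.vertices, x ∈ S

/-- The highway dimension: the smallest `h` with `HighwayBound G w h`. -/
def highwayDim (G : Graph α β) (w : β → ℝ) : ℕ := sInf {h | G.HighwayBound w h}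

/-- One end of an edge (an arbitrary orientation, used to number the points of a subdivision). -/
def src (G : Graph α β) (e : E(G)) : α := (G.exists_isLink_of_mem_edgeSet e.2).choose

/-- The other end of an edge. -/
def tgt (G : Graph α β) (e : E(G)) : α := (G.exists_isLink_of_mem_edgeSet e.2).choose_spec.choose

lemma isLink_src_tgt (G : Graph α β) (e : E(G)) : G.IsLink e (G.src e) (G.tgt e) :=
  (G.exists_isLink_of_mem_edgeSet e.2).choose_spec.choose_spec

/-- The `j`-th point, `0 ≤ j ≤ k`, of the path of `k` edges that replaces the edge `e`. -/
def subdivPoint (G : Graph α β) (k : ℕ) (e : E(G)) (j : ℕ) : α ⊕ E(G) × ℕ :=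
  if j = 0 then .inl (G.src e) else if j = k then .inl (G.tgt e) else .inr (e, j)

/-- The graph `G_k`, in which every edge of `G` is replaced with a path of `k` edges. The `j`-th
edge of that path joins its `j`-th and `(j+1)`-st points. -/
def subdiv (G : Graph α β) (k : ℕ) : Graph (α ⊕ E(G) × ℕ) (E(G) × Fin k) where
  vertexSet := Sum.inl '' V(G) ∪ {x | ∃ (e : E(G)) (j : ℕ), 0 < j ∧ j < k ∧ x = .inr (e, j)}
  edgeSet := Set.univ
  IsLink f x y := s(x, y) = s(G.subdivPoint k f.1 f.2, G.subdivPoint k f.1 (f.2 + 1))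
  isLink_symm := fun _ _ => ⟨fun x y h => by rw [Sym2.eq_swap]; exact h⟩
  eq_or_eq_of_isLink_of_isLink := by
    intro f x y v z h h'
    have := h.trans h'.symm
    rcases Sym2.eq_iff.1 this with ⟨h1, _⟩ | ⟨h1, _⟩
    · exact Or.inl h1
    · exact Or.inr h1
  edge_mem_iff_exists_isLink := fun f => ⟨fun _ => ⟨_, _, rfl⟩, fun _ => trivial⟩
  left_mem_of_isLink := by
    have key : ∀ (e : E(G)) (j : ℕ), j ≤ k → G.subdivPoint k e j ∈
        Sum.inl '' V(G) ∪ {x | ∃ (e : E(G)) (j : ℕ), 0 < j ∧ j < k ∧ x = .inr (e, j)} := by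
      intro e j hj
      unfold subdivPoint
      split_ifs with h1 h2
      · exact Or.inl ⟨_, (G.isLink_src_tgt e).left_mem, rfl⟩
      · exact Or.inl ⟨_, (G.isLink_src_tgt e).right_mem, rfl⟩
      · exact Or.inr ⟨e, j, by omega, by omega, rfl⟩
    intro f x y h
    have hk := f.2.isLt
    rcases Sym2.eq_iff.1 h with ⟨h1, _⟩ | ⟨h1, _⟩
    · rw [h1]; exact key _ _ (by omega)
    · rw [h1]; exact key _ _ (by omega)

/-- Each of the `k` pieces of an edge gets `1 / k` times the weight of the edge. -/
def subdivWeight (G : Graph α β) (w : β → ℝ) (k : ℕ) : E(G) × Fin k → ℝ := fun f => w f.1 / k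

/-- `G` has continuous highway dimension `h`: the highway dimensions of the subdivisions `G_k`
tend to `h` as `k → ∞`. -/
def HasContinuousHighwayDim (G : Graph α β) (w : β → ℝ) (h : ℕ) : Prop :=
  Tendsto (fun k : ℕ => (G.subdiv k).highwayDim (G.subdivWeight w k)) atTop (𝓝 h)

end Graph

/-! ### The correlated demand model -/

/-- A weighted graph with `m` demands: the demand `y i` is distributed as `law i`, a probability
measure on `[lo i, ρ * lo i]`, independently for different `i`, and an edge `e` has actual weight
`(∑ i, dep i e * y i) ^ expo * w e`. -/
structure DemandModel (α β : Type*) (m : ℕ) where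
  /-- the underlying graph -/
  G : Graph α β
  /-- the edge weights -/
  w : β → ℝ
  /-- the lowest possible values of the demands -/
  lo : Fin m → ℝ
  /-- the ratio between the largest and the lowest possible value of a demand -/
  ρ : ℝ
  /-- the exponent of the power function -/
  expo : ℝ
  /-- the dependence parameters -/
  dep : Fin m → β → ℝ
  /-- the laws of the demands -/
  law : Fin m → Measure ℝ
  w_nonneg : ∀ e, 0 ≤ w e
  lo_nonneg : ∀ i, 0 ≤ lo i
  one_le_ρ : 1 ≤ ρ
  expo_nonneg : 0 ≤ expo
  dep_nonneg : ∀ i e, 0 ≤ dep i e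
  isProb : ∀ i, IsProbabilityMeasure (law i)
  law_mem : ∀ i, ∀ᵐ x ∂(law i), x ∈ Set.Icc (lo i) (ρ * lo i)

namespace DemandModel

variable {α β : Type*} {m : ℕ} (M : DemandModel α β m)

instance (i : Fin m) : IsProbabilityMeasure (M.law i) := M.isProb i

/-- The number of vertices. -/
def n : ℕ := V(M.G).ncard

/-- The edge weights when the demands are `y`. -/
def weight (y : Fin m → ℝ) (e : β) : ℝ := (∑ i, M.dep i e * y i) ^ M.expo * M.w e

/-- The edge weights under basic demands. -/
def basicWeight : β → ℝ := M.weight M.lo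

/-- The cluster of a demand: the edges that it influences. -/
def cluster (i : Fin m) : Set β := {e | e ∈ E(M.G) ∧ 0 < M.dep i e}

/-- The joint law of the independent demands. -/
def demandLaw : Measure (Fin m → ℝ) := Measure.pi M.law

/-! The probing algorithm, run with source `s`, target `t`, accuracy `ε` and overlap bound `ℓ`. -/

/-- `L`, the distance from `s` to `t` under basic demands. -/
def basicDist (s t : α) : ℝ := M.G.wdist M.basicWeight s t

/-- `H`, the subgraph induced by the ball of radius `ρ ^ expo * L` around `s` under basic
demands. -/
def searchGraph (s t : α) : Graph α β :=
  M.G.induce (M.G.wball M.basicWeight s (M.ρ ^ M.expo * M.basicDist s t))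

open Classical in
/-- The size, under basic demands, of the part of the cluster of `i` that lies in `H`. -/
def clusterSize [Fintype β] (s t : α) (i : Fin m) : ℝ :=
  ∑ e with e ∈ E(M.searchGraph s t) ∧ e ∈ M.cluster i, M.basicWeight e

/-- The threshold for probing. -/
def threshold (s t : α) (ε : ℝ) (ℓ : ℕ) : ℝ :=
  ε ^ 2 * M.basicDist s t / (16 * Real.log (2 * M.n) * M.ρ ^ (3 * M.expo) * ℓ)

open Classical in
/-- The demands that the algorithm probes. -/
def probed [Fintype β] (s t : α) (ε : ℝ) (ℓ : ℕ) : Finset (Fin m) :=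
  {i | M.threshold s t ε ℓ < M.clusterSize s t i}

open Classical in
/-- The demands that the algorithm works with: the true value `y i` if `i` is probed, and the
algorithm's own sample `z i` otherwise. -/
def simulated [Fintype β] (s t : α) (ε : ℝ) (ℓ : ℕ) (y z : Fin m → ℝ) (i : Fin m) : ℝ :=
  if i ∈ M.probed s t ε ℓ then y i else z i

/-- The value that the algorithm returns, for true demands `y` and own samples `z`. -/
def output [Fintype β] (s t : α) (ε : ℝ) (ℓ : ℕ) (y z : Fin m → ℝ) : ℝ :=
  (M.searchGraph s t).wdist (M.weight (M.simulated s t ε ℓ y z)) s t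

end DemandModel

end

/-! Write P = ρ^β, L for the basic distance from s to t, and τ for the probing threshold.

Few probes. A probed cluster is a shortest path with weight more than τ inside the ball of radius R
= PL around s. Take a subdivision so fine that its highway dimension equals h and its edges are
short. Hubs at scale r, together with the center, cover a ball of radius 4r by h + 1 balls of radius
2r; iteration gives (h + 1)^J balls of radius R/2^J (`HighwayBound.exists_cover_iterate`), with J
logarithmic in (ln n)Pℓ/ε². After its first visit to the ball around s, a probed path starts in one
of the small balls and is long enough for an initial piece to meet one of the h hubs attached to
that ball. Hubs also bound degrees: a positive edge leaving a vertex contains two disjoint short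
segments near it, each needing its own hub (`two_mul_card_le_of_highwayBound`). So the paths through
a hub use at most h edges (`exists_hub_edges`), each in at most ℓ clusters. The total is (h + 1)^J ·
h · h · ℓ (`card_le_of_highwayBound`). A probe forces h ≥ 2, so all factors fit into an exponent of
order ln h.

Accuracy. Exchanging unprobed coordinates of the demands y and the samples z preserves their joint
law. Hence it suffices to fix y and z and to count the σ in the hypercube for which the distance
g(σ), with unprobed demands selected by σ, is more than εL away from its value at the opposite
point. A shortest path at σ is a certificate (`InRange.exists_certificate`): changing coordinate i
lengthens it by at most aᵢ, P times the basic weight it has in cluster i. Here aᵢ ≤ Pτ because i is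
unprobed, and ∑ aᵢ ≤ P²ℓL by the overlap bound, so ∑ aᵢ² ≤ P³τℓL = ε²L²/(16 ln(2n)). The aᵢ depend
on σ, so the concentration is of Talagrand's type: an induction on the dimension
(`exists_transport_function`) bounds the product of the exponential moments of g and -g, and
Cauchy–Schwarz and Markov give `card_antipodal_le`. The threshold is tuned so that the failure
probability becomes 2 · 1/(2n). -/

noncomputable section

namespace Graph

variable {α β : Type*} {G : Graph α β} {w : β → ℝ}

/-! ### Operations on walks -/

namespace Walk

lemma left_mem {u v : α} (p : G.Walk u v) : u ∈ V(G) := by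
  cases p with
  | nil hu => exact hu
  | cons e he p => exact he.left_mem

lemma right_mem {u v : α} (p : G.Walk u v) : v ∈ V(G) := by
  induction p with
  | nil hu => exact hu
  | cons e he p ih => exact ih

lemma start_mem_vertices {u v : α} (p : G.Walk u v) : u ∈ p.vertices := by
  cases p <;> simp [vertices]

lemma end_mem_vertices {u v : α} (p : G.Walk u v) : v ∈ p.vertices := by
  induction p with
  | nil hu => simp [vertices]
  | cons e he p ih => simp [vertices, ih]

@[simp] lemma length_nil {u : α} (hu : u ∈ V(G)) : (Walk.nil hu).length w = 0 := by
  simp [length, edges]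

@[simp] lemma length_cons {u v x : α} (e : β) (he : G.IsLink e u v) (p : G.Walk v x) :
    (Walk.cons e he p).length w = w e + p.length w := by
  simp [length, edges]

lemma length_nonneg (hw : ∀ e, 0 ≤ w e) {u v : α} (p : G.Walk u v) : 0 ≤ p.length w := by
  induction p with
  | nil hu => simp
  | cons e he p ih => simpa using add_nonneg (hw e) ih

lemma mem_edgeSet_of_mem_edges {u v : α} (p : G.Walk u v) {e : β} (he : e ∈ p.edges) :
    e ∈ E(G) := by
  induction p with
  | nil hu => simp [edges] at he
  | cons e' he' p ih =>
    simp only [edges, List.mem_cons] at he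
    rcases he with rfl | he
    · exact he'.edge_mem
    · exact ih he

lemma mem_vertices_of_isLink {u v : α} (p : G.Walk u v) {e : β} (he : e ∈ p.edges) {a b : α}
    (hab : G.IsLink e a b) : a ∈ p.vertices ∧ b ∈ p.vertices := by
  induction p with
  | nil hu => simp [edges] at he
  | cons e' he' p ih =>
    simp only [edges, List.mem_cons] at he
    rcases he with rfl | he
    · rcases hab.eq_and_eq_or_eq_and_eq he' with ⟨rfl, rfl⟩ | ⟨rfl, rfl⟩ <;>
        simp [vertices, start_mem_vertices]
    · simp [vertices, ih he]

lemma edges_nodup {u v : α} (p : G.Walk u v) (hp : p.vertices.Nodup) : p.edges.Nodup := by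
  induction p with
  | nil hu => simp [edges]
  | cons e he p ih =>
    simp only [vertices, List.nodup_cons] at hp
    simp only [edges, List.nodup_cons]
    exact ⟨fun h => hp.1 (p.mem_vertices_of_isLink h he).1, ih hp.2⟩

/-- Concatenation of walks. -/
def append : {u v x : α} → G.Walk u v → G.Walk v x → G.Walk u x
  | _, _, _, .nil _, q => q
  | _, _, _, .cons e he p, q => .cons e he (p.append q)

@[simp] lemma length_append {u v x : α} (p : G.Walk u v) (q : G.Walk v x) :
    (p.append q).length w = p.length w + q.length w := by
  induction p with
  | nil hu => simp [append]
  | cons e he p ih => simp [append, ih, add_assoc]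

@[simp] lemma edges_append {u v x : α} (p : G.Walk u v) (q : G.Walk v x) :
    (p.append q).edges = p.edges ++ q.edges := by
  induction p with
  | nil hu => simp [append, edges]
  | cons e he p ih => simp [append, ih, edges]

lemma mem_vertices_append {u v x y : α} (p : G.Walk u v) (q : G.Walk v x) :
    y ∈ (p.append q).vertices ↔ y ∈ p.vertices ∨ y ∈ q.vertices := by
  induction p with
  | nil hu =>
    simp only [append, vertices, List.mem_singleton]
    exact ⟨Or.inr, fun h => h.elim (fun h => h ▸ q.start_mem_vertices) id⟩
  | cons e he p ih => simp [append, vertices, ih, or_assoc]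

lemma nodup_append {u v x : α} (p : G.Walk u v) (q : G.Walk v x) (hp : p.vertices.Nodup)
    (hq : q.vertices.Nodup) (h : ∀ y ∈ p.vertices, y ∈ q.vertices → y = v) :
    (p.append q).vertices.Nodup := by
  induction p with
  | nil hu => simpa [append] using hq
  | cons e he p ih =>
    simp only [vertices, List.nodup_cons] at hp
    simp only [append, vertices, List.nodup_cons, mem_vertices_append]
    refine ⟨?_, ih q hp.2 hq fun y hy => h y (by simp [vertices, hy])⟩
    rintro (h1 | h1)
    · exact hp.1 h1
    · have := h _ (by simp [vertices]) h1
      exact hp.1 (this ▸ p.end_mem_vertices)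

lemma nodup_of_append {u v x : α} (p : G.Walk u v) (q : G.Walk v x)
    (h : (p.append q).vertices.Nodup) : p.vertices.Nodup ∧ q.vertices.Nodup := by
  induction p with
  | nil hu => exact ⟨by simp [vertices], h⟩
  | cons e he p ih =>
    simp only [append, vertices, List.nodup_cons, mem_vertices_append, not_or] at h
    exact ⟨by simp [vertices, h.1.1, (ih q h.2).1], (ih q h.2).2⟩

lemma exists_reverse (w : β → ℝ) {u v : α} (p : G.Walk u v) :
    ∃ q : G.Walk v u, q.length w = p.length w := by
  induction p with
  | nil hu => exact ⟨.nil hu, rfl⟩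
  | cons e he p ih =>
    obtain ⟨q, hq⟩ := ih
    exact ⟨q.append (.cons e he.symm (.nil he.left_mem)), by simp [hq, add_comm]⟩

lemma exists_eq_append_of_mem {u v x : α} (p : G.Walk u v) (hx : x ∈ p.vertices) :
    ∃ (p₁ : G.Walk u x) (p₂ : G.Walk x v), p = p₁.append p₂ := by
  induction p with
  | nil hu =>
    simp only [vertices, List.mem_singleton] at hx
    subst hx
    exact ⟨.nil hu, .nil hu, rfl⟩
  | @cons u y v e he p ih =>
    by_cases hxu : x = u
    · subst hxu
      exact ⟨.nil he.left_mem, .cons e he p, rfl⟩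
    · simp only [vertices, List.mem_cons, hxu, false_or] at hx
      obtain ⟨p₁, p₂, rfl⟩ := ih hx
      exact ⟨.cons e he p₁, p₂, rfl⟩

lemma exists_nodup (hw : ∀ e, 0 ≤ w e) {u v : α} (p : G.Walk u v) :
    ∃ q : G.Walk u v, q.vertices.Nodup ∧ q.length w ≤ p.length w := by
  induction p with
  | nil hu => exact ⟨.nil hu, by simp [vertices], le_rfl⟩
  | @cons u y v e he p ih =>
    obtain ⟨q, hq, hle⟩ := ih
    by_cases hu : u ∈ q.vertices
    -- The walk returns to `u`; dropping the closed part cannot lengthen it.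
    · obtain ⟨q₁, q₂, rfl⟩ := q.exists_eq_append_of_mem hu
      refine ⟨q₂, (nodup_of_append _ _ hq).2, ?_⟩
      have := q₁.length_nonneg hw
      have := hw e
      simp only [length_append, length_cons] at *
      linarith
    · exact ⟨.cons e he q, by simp [vertices, hu, hq], by simpa using hle⟩

/-- Cutting at the first visit to `B` loses no edge with both ends in `B`, since all earlier
vertices are outside `B`. -/
lemma exists_first_mem (B : Set α) {u v : α} (p : G.Walk u v) (hB : ∃ x ∈ p.vertices, x ∈ B) :
    ∃ y ∈ B, ∃ (p₁ : G.Walk u y) (p₂ : G.Walk y v), p = p₁.append p₂ ∧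
      ∀ e ∈ p.edges, ∀ a b, G.IsLink e a b → a ∈ B → b ∈ B → e ∈ p₂.edges := by
  induction p with
  | @nil u hu =>
    obtain ⟨x, hx, hxB⟩ := hB
    simp only [vertices, List.mem_singleton] at hx
    subst hx
    exact ⟨x, hxB, .nil hu, .nil hu, rfl, by simp [edges]⟩
  | @cons u y v e he p ih =>
    by_cases hu : u ∈ B
    · exact ⟨u, hu, .nil he.left_mem, .cons e he p, rfl, fun e he _ _ _ _ _ => he⟩
    · obtain ⟨x, hx, hxB⟩ := hB
      simp only [vertices, List.mem_cons] at hx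
      have hx' : x ∈ p.vertices := hx.resolve_left fun h => hu (h ▸ hxB)
      obtain ⟨z, hz, p₁, p₂, rfl, h⟩ := ih ⟨x, hx', hxB⟩
      refine ⟨z, hz, .cons e he p₁, p₂, rfl, fun f hf a b hab ha hb => ?_⟩
      simp only [edges, List.mem_cons] at hf
      rcases hf with rfl | hf
      · rcases hab.eq_and_eq_or_eq_and_eq he with ⟨rfl, rfl⟩ | ⟨rfl, rfl⟩
        · exact absurd ha hu
        · exact absurd hb hu
      · exact h f hf a b hab ha hb

/-- The first prefix to exceed `r` overshoots by at most its last edge. -/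
lemma exists_prefix {η : ℝ} (hη : ∀ e, w e ≤ η) {u v : α} (p : G.Walk u v) :
    ∀ r : ℝ, 0 ≤ r → r < p.length w →
      ∃ (x : α) (p₁ : G.Walk u x) (p₂ : G.Walk x v), p = p₁.append p₂ ∧ r < p₁.length w ∧
        p₁.length w ≤ r + η := by
  induction p with
  | nil hu => intro r hr h; simp at h; linarith
  | @cons u y v e he p ih =>
    intro r hr h
    by_cases hre : r < w e
    · exact ⟨y, .cons e he (.nil he.right_mem), p, rfl, by simpa using hre, by
        have := hη e
        simp; linarith⟩
    · simp only [length_cons] at h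
      obtain ⟨x, p₁, p₂, rfl, h1, h2⟩ := ih (r - w e) (by linarith) (by linarith)
      exact ⟨x, .cons e he p₁, p₂, rfl, by simp; linarith, by simp; linarith⟩

/-- If no edge of a walk crosses the boundary of `Z`, the walk stays inside or outside `Z`. -/
lemma mem_iff_of_no_boundary_edge (Z : Set α) {u v : α} (p : G.Walk u v)
    (h : ∀ e ∈ p.edges, ∀ x y, G.IsLink e x y → x ∈ Z → y ∈ Z) {a : α} (ha : a ∈ p.vertices) :
    a ∈ Z ↔ u ∈ Z := by
  induction p with
  | nil hu =>
    simp only [vertices, List.mem_singleton] at ha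
    rw [ha]
  | @cons u y v e he p ih =>
    simp only [vertices, List.mem_cons] at ha
    rcases ha with rfl | ha
    · rfl
    · rw [ih (fun f hf => h f (by simp [edges, hf])) ha]
      exact ⟨h e (by simp [edges]) _ _ he.symm, h e (by simp [edges]) _ _ he⟩

lemma sub_le_length {f : α → ℝ} (hf : ∀ e x y, G.IsLink e x y → f y - f x ≤ w e) {u v : α}
    (p : G.Walk u v) : f v - f u ≤ p.length w := by
  induction p with
  | nil hu => simp
  | cons e he p ih =>
    have := hf _ _ _ he
    simp only [length_cons]
    linarith

/-- Linear programming duality: a potential that grows by at most `w e` along each edge bounds every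
walk from below, so it certifies a walk that attains the bound. -/
lemma isShortestPath_of_potential {f : α → ℝ} (hf : ∀ e x y, G.IsLink e x y → f y - f x ≤ w e)
    {u v : α} (p : G.Walk u v) (hp : p.vertices.Nodup) (h : p.length w ≤ f v - f u) :
    p.IsShortestPath w :=
  ⟨hp, fun q => h.trans (q.sub_le_length hf)⟩

lemma IsShortestPath.left {u v x : α} {p : G.Walk u v} {q : G.Walk v x}
    (h : (p.append q).IsShortestPath w) : p.IsShortestPath w :=
  ⟨(nodup_of_append _ _ h.1).1, fun p' => by
    have := h.2 (p'.append q)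
    simp only [length_append] at this
    linarith⟩

lemma IsShortestPath.right {u v x : α} {p : G.Walk u v} {q : G.Walk v x}
    (h : (p.append q).IsShortestPath w) : q.IsShortestPath w :=
  ⟨(nodup_of_append _ _ h.1).2, fun q' => by
    have := h.2 (p.append q')
    simp only [length_append] at this
    linarith⟩

/-- Only walks without repeated vertices compete. Their edge lists have no duplicates, so there are
finitely many lengths to minimize over. -/
lemma exists_isShortestPath [Finite β] (hw : ∀ e, 0 ≤ w e) {u v : α} (p : G.Walk u v) :
    ∃ q : G.Walk u v, q.IsShortestPath w := by
  classical
  have := Fintype.ofFinite β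
  let T : Set {l : List β // l.Nodup} :=
    {l | ∃ q : G.Walk u v, q.vertices.Nodup ∧ q.edges = l.1}
  have hT : T.Nonempty := by
    obtain ⟨q, hq, -⟩ := p.exists_nodup hw
    exact ⟨⟨q.edges, q.edges_nodup hq⟩, q, hq, rfl⟩
  have : Fintype {l : List β // l.Nodup} := fintypeNodupList
  obtain ⟨l, ⟨q, hq, hql⟩, hmin⟩ := T.toFinite.exists_minimalFor
    (fun l : {l : List β // l.Nodup} => (l.1.map w).sum) T hT
  refine ⟨q, hq, fun q' => ?_⟩
  obtain ⟨q'', hq'', hle⟩ := q'.exists_nodup hw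
  refine le_trans ?_ hle
  have h := hmin (j := ⟨q''.edges, q''.edges_nodup hq''⟩) ⟨q'', hq'', rfl⟩
  simp only [length, hql]
  rcases le_total (l.1.map w).sum (q''.edges.map w).sum with h' | h'
  · exact h'
  · exact h h'

end Walk

/-! ### The distance -/

lemma bddBelow_length (hw : ∀ e, 0 ≤ w e) (u v : α) :
    BddBelow (Set.range fun p : G.Walk u v => p.length w) :=
  ⟨0, by rintro _ ⟨p, rfl⟩; exact p.length_nonneg hw⟩

lemma wdist_le_length (hw : ∀ e, 0 ≤ w e) {u v : α} (p : G.Walk u v) :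
    G.wdist w u v ≤ p.length w :=
  ciInf_le (bddBelow_length hw u v) p

lemma le_wdist {u v : α} (h : G.Reachable u v) {a : ℝ} (ha : ∀ p : G.Walk u v, a ≤ p.length w) :
    a ≤ G.wdist w u v :=
  have : Nonempty (G.Walk u v) := h
  le_ciInf ha

lemma wdist_nonneg (hw : ∀ e, 0 ≤ w e) (u v : α) : 0 ≤ G.wdist w u v :=
  Real.iInf_nonneg fun p => p.length_nonneg hw

lemma wdist_self (hw : ∀ e, 0 ≤ w e) {u : α} (hu : u ∈ V(G)) : G.wdist w u u = 0 :=
  le_antisymm (by simpa using wdist_le_length hw (Walk.nil hu)) (wdist_nonneg hw u u)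

lemma Walk.IsShortestPath.length_eq (hw : ∀ e, 0 ≤ w e) {u v : α} {p : G.Walk u v}
    (hp : p.IsShortestPath w) : p.length w = G.wdist w u v :=
  le_antisymm (le_wdist ⟨p⟩ hp.2) (wdist_le_length hw p)

lemma Reachable.symm {u v : α} (h : G.Reachable u v) : G.Reachable v u :=
  h.elim fun p => ⟨(p.exists_reverse fun _ => 0).choose⟩

lemma Reachable.trans {u v x : α} (h : G.Reachable u v) (h' : G.Reachable v x) :
    G.Reachable u x :=
  h.elim fun p => h'.elim fun q => ⟨p.append q⟩

lemma wdist_comm (hw : ∀ e, 0 ≤ w e) (u v : α) : G.wdist w u v = G.wdist w v u := by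
  have key : ∀ u v, G.Reachable v u → G.wdist w u v ≤ G.wdist w v u := by
    intro u v h
    refine le_wdist h fun p => ?_
    obtain ⟨q, hq⟩ := p.exists_reverse w
    exact hq ▸ wdist_le_length hw q
  by_cases h : G.Reachable u v
  · exact le_antisymm (key _ _ h.symm) (key _ _ h)
  · have h' : ¬ G.Reachable v u := fun h' => h h'.symm
    have : IsEmpty (G.Walk u v) := not_nonempty_iff.1 h
    have : IsEmpty (G.Walk v u) := not_nonempty_iff.1 h'
    simp [wdist, Real.iInf_of_isEmpty]

lemma wdist_triangle (hw : ∀ e, 0 ≤ w e) {u v x : α} (h : G.Reachable u v)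
    (h' : G.Reachable v x) : G.wdist w u x ≤ G.wdist w u v + G.wdist w v x := by
  rw [← sub_le_iff_le_add]
  refine le_wdist h fun p => ?_
  rw [sub_le_comm]
  refine le_wdist h' fun q => ?_
  have := wdist_le_length hw (p.append q)
  simp only [Walk.length_append] at this
  linarith

lemma IsLink.wdist_le (hw : ∀ e, 0 ≤ w e) {e : β} {x y : α} (h : G.IsLink e x y) :
    G.wdist w x y ≤ w e := by
  simpa using wdist_le_length hw (Walk.cons e h (.nil h.right_mem))

lemma IsLink.reachable {e : β} {x y : α} (h : G.IsLink e x y) : G.Reachable x y :=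
  ⟨.cons e h (.nil h.right_mem)⟩

lemma wdist_sub_le (hw : ∀ e, 0 ≤ w e) (u : α) (e : β) (x y : α) (h : G.IsLink e x y) :
    G.wdist w u y - G.wdist w u x ≤ w e := by
  by_cases hx : G.Reachable u x
  · have := wdist_triangle hw hx h.reachable
    have := h.wdist_le hw
    linarith
  -- If `x` is unreachable, so is `y`, and both infima over the empty type have the default value 0.
  · have hy : ¬ G.Reachable u y := fun hy => hx (hy.trans h.symm.reachable)
    have : IsEmpty (G.Walk u x) := not_nonempty_iff.1 hx
    have : IsEmpty (G.Walk u y) := not_nonempty_iff.1 hy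
    simp [wdist, Real.iInf_of_isEmpty, hw e]

lemma Walk.wdist_le_of_mem (hw : ∀ e, 0 ≤ w e) {u v x : α} (p : G.Walk u v)
    (hx : x ∈ p.vertices) :
    G.Reachable u x ∧ G.Reachable x v ∧ G.wdist w u x ≤ p.length w ∧
      G.wdist w x v ≤ p.length w := by
  obtain ⟨p₁, p₂, rfl⟩ := p.exists_eq_append_of_mem hx
  have h1 := p₁.length_nonneg hw
  have h2 := p₂.length_nonneg hw
  have h3 := wdist_le_length hw p₁
  have h4 := wdist_le_length hw p₂
  rw [Walk.length_append]
  exact ⟨⟨p₁⟩, ⟨p₂⟩, by linarith, by linarith⟩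

/-- An edge of a shortest path is itself a shortest path. -/
lemma Walk.IsShortestPath.weight_le_wdist {u v : α} {p : G.Walk u v}
    (hp : p.IsShortestPath w) {e : β} (he : e ∈ p.edges) {a b : α} (hab : G.IsLink e a b)
    (hw : ∀ e, 0 ≤ w e) : w e ≤ G.wdist w a b := by
  induction p with
  | nil hu => simp [Walk.edges] at he
  | @cons u y v f hf p ih =>
    simp only [Walk.edges, List.mem_cons] at he
    rcases he with rfl | he
    · have key : w e ≤ G.wdist w u y := by
        refine le_wdist hf.reachable fun q => ?_
        have := hp.2 (q.append p)
        simp only [length_append, length_cons] at this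
        linarith
      rcases hab.eq_and_eq_or_eq_and_eq hf with ⟨rfl, rfl⟩ | ⟨rfl, rfl⟩
      · exact key
      · rwa [wdist_comm hw]
    · exact ih (IsShortestPath.right (p := .cons f hf (.nil hf.right_mem)) hp) he

lemma wball_subset (u : α) (r : ℝ) : G.wball w u r ⊆ V(G) :=
  fun _ hv => hv.1.elim fun p => p.right_mem

/-! ### Walks in induced subgraphs -/

lemma Walk.exists_of_induce {X : Set α} (hX : X ⊆ V(G)) {u v : α} (p : (G.induce X).Walk u v) :
    ∃ q : G.Walk u v, q.edges = p.edges := by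
  induction p with
  | nil hu => exact ⟨.nil (hX hu), rfl⟩
  | cons e he p ih =>
    obtain ⟨q, hq⟩ := ih
    exact ⟨.cons e he.1 q, by simp [edges, hq]⟩

lemma Walk.exists_induce {X : Set α} {u v : α} (p : G.Walk u v) (hp : ∀ x ∈ p.vertices, x ∈ X) :
    ∃ q : (G.induce X).Walk u v, q.edges = p.edges := by
  induction p with
  | nil hu => exact ⟨.nil (hp _ (by simp [vertices])), rfl⟩
  | cons e he p ih =>
    obtain ⟨q, hq⟩ := ih fun x hx => hp x (by simp [vertices, hx])
    exact ⟨.cons e ⟨he, hp _ (by simp [vertices]), hp _ (by simp [vertices, start_mem_vertices])⟩ q,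
      by simp [edges, hq]⟩

/-! ### Covering balls -/

/-- Under a highway bound and short edges, a ball is covered by `h + 1` balls of half the
radius. -/
lemma HighwayBound.exists_cover [Finite β] (hw : ∀ e, 0 ≤ w e) {h : ℕ}
    (hb : G.HighwayBound w h) {r η : ℝ} (hr : 0 < r) (hη : ∀ e, w e ≤ η) (hηr : η ≤ r) {u : α}
    (hu : u ∈ V(G)) :
    ∃ T : Finset α, (T : Set α) ⊆ V(G) ∧ T.card ≤ h + 1 ∧
      ∀ v ∈ G.wball w u (4 * r), ∃ c ∈ T, v ∈ G.wball w c (2 * r) := by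
  classical
  obtain ⟨S, hS, hcard, hhit⟩ := hb r hr u hu
  refine ⟨insert u S, ?_, (Finset.card_insert_le _ _).trans (by omega), fun v hv => ?_⟩
  · rw [Finset.coe_insert]
    exact Set.insert_subset hu (hS.trans (wball_subset _ _))
  · by_cases hd : G.wdist w u v ≤ 2 * r
    · exact ⟨u, by simp, hv.1, hd⟩
    · push Not at hd
      obtain ⟨p, hp⟩ := hv.1.symm.elim fun p => p.exists_isShortestPath hw
      have hlen := hp.length_eq hw
      rw [wdist_comm hw] at hlen
      -- `p` runs from `v` to `u`. Its prefix has length between `r` and `r + η ≤ 2 * r`, so the hub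
      -- on it is within `2 * r` of `v`.
      obtain ⟨x, p₁, p₂, rfl, h1, h2⟩ := p.exists_prefix hη r hr.le (by linarith)
      have hin : ∀ y ∈ p₁.vertices, y ∈ G.wball w u (4 * r) := by
        intro y hy
        obtain ⟨-, h3, -, h4⟩ := (p₁.append p₂).wdist_le_of_mem hw
          ((p₁.mem_vertices_append p₂).2 (Or.inl hy))
        exact ⟨h3.symm, by rw [wdist_comm hw]; linarith [hv.2]⟩
      obtain ⟨c, hc, hcS⟩ := hhit v (hin _ p₁.start_mem_vertices) x (hin _ p₁.end_mem_vertices) p₁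
        hp.left h1 hin
      obtain ⟨h3, -, h4, -⟩ := p₁.wdist_le_of_mem hw hc
      exact ⟨c, by simp [hcS], h3.symm, by rw [wdist_comm hw]; linarith⟩

/-- Each of the `J` halvings costs a factor `h + 1`. The last one uses the highway bound at scale `R
/ 2 ^ (J + 1)`, which the edge lengths must not exceed. -/
lemma HighwayBound.exists_cover_iterate [Finite β] (hw : ∀ e, 0 ≤ w e) {h : ℕ}
    (hb : G.HighwayBound w h) {R η : ℝ} (hR : 0 < R) (hη : ∀ e, w e ≤ η) {u : α}
    (hu : u ∈ V(G)) (J : ℕ) (hJ : η ≤ R / 2 ^ (J + 1)) :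
    ∃ T : Finset α, (T : Set α) ⊆ V(G) ∧ T.card ≤ (h + 1) ^ J ∧
      ∀ v ∈ G.wball w u R, ∃ c ∈ T, v ∈ G.wball w c (R / 2 ^ J) := by
  classical
  induction J with
  | zero => exact ⟨{u}, by simpa using hu, by simp, fun v hv => ⟨u, by simp, by simpa using hv⟩⟩
  | succ J ih =>
    have hpos : 0 < R / 2 ^ (J + 2) := by positivity
    have e1 : R / 2 ^ (J + 1) = 2 * (R / 2 ^ (J + 2)) := by field_simp; ring
    have e2 : R / 2 ^ J = 4 * (R / 2 ^ (J + 2)) := by field_simp; ring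
    obtain ⟨T, hT, hcard, hcov⟩ := ih (by rw [e1]; linarith)
    choose! F hF1 hF2 hF3 using fun c (hc : c ∈ T) =>
      hb.exists_cover hw hpos hη hJ (hT hc)
    refine ⟨T.biUnion F, ?_, ?_, fun v hv => ?_⟩
    · rw [Finset.coe_biUnion]
      exact Set.iUnion₂_subset hF1
    · rw [pow_succ]
      exact (Finset.card_biUnion_le_card_mul _ _ _ hF2).trans (Nat.mul_le_mul_right _ hcard)
    · obtain ⟨c, hc, hvc⟩ := hcov v hv
      rw [e2] at hvc
      obtain ⟨d, hd, hvd⟩ := hF3 c hc v hvc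
      exact ⟨d, Finset.mem_biUnion.2 ⟨c, hc, hd⟩, by rwa [e1]⟩

/-- The whole ball is a hitting set, so the `sInf` defining `highwayDim` is over a nonempty set and
is attained. -/
lemma exists_highwayBound (hV : V(G).Finite) : ∃ h, G.HighwayBound w h := by
  classical
  refine ⟨hV.toFinset.card, fun r hr u hu => ?_⟩
  have hfin : (G.wball w u (4 * r)).Finite := hV.subset (wball_subset _ _)
  refine ⟨hfin.toFinset, by simp, Finset.card_le_card fun x hx => ?_, fun v hv v' hv' p hp hr h =>
    ⟨v, p.start_mem_vertices, by simpa using hv⟩⟩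
  simp only [Set.Finite.mem_toFinset] at hx ⊢
  exact wball_subset _ _ hx

lemma highwayBound_highwayDim (hV : V(G).Finite) : G.HighwayBound w (G.highwayDim w) :=
  Nat.sInf_mem (exists_highwayBound hV)

end Graph

namespace Graph

variable {α β : Type*} {G : Graph α β} {w : β → ℝ} {k : ℕ}

/-! ### Walks in subdivisions -/

lemma subdivPoint_zero (G : Graph α β) (k : ℕ) (e : E(G)) :
    G.subdivPoint k e 0 = .inl (G.src e) := by simp [subdivPoint]

lemma subdivPoint_self (G : Graph α β) (hk : 0 < k) (e : E(G)) :
    G.subdivPoint k e k = .inl (G.tgt e) := by simp [subdivPoint, hk.ne']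

lemma subdivPoint_of_lt (G : Graph α β) (e : E(G)) {j : ℕ} (h0 : 0 < j) (hj : j < k) :
    G.subdivPoint k e j = .inr (e, j) := by simp [subdivPoint, h0.ne', hj.ne]

lemma subdiv_isLink (G : Graph α β) (e : E(G)) {j : ℕ} (hj : j < k) :
    (G.subdiv k).IsLink (e, ⟨j, hj⟩) (G.subdivPoint k e j) (G.subdivPoint k e (j + 1)) := rfl

lemma inl_mem_subdiv {v : α} (hv : v ∈ V(G)) : (.inl v : α ⊕ E(G) × ℕ) ∈ V(G.subdiv k) :=
  Or.inl ⟨v, hv, rfl⟩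

lemma subdivPoint_mem (e : E(G)) {j : ℕ} (hj : j ≤ k) :
    G.subdivPoint k e j ∈ V(G.subdiv k) := by
  unfold subdivPoint
  split_ifs with h1 h2
  · exact Or.inl ⟨_, (G.isLink_src_tgt e).left_mem, rfl⟩
  · exact Or.inl ⟨_, (G.isLink_src_tgt e).right_mem, rfl⟩
  · exact Or.inr ⟨e, j, by omega, by omega, rfl⟩

lemma subdiv_vertexSet_finite [Finite α] [Finite β] : V(G.subdiv k).Finite := by
  refine Set.Finite.union (Set.toFinite _) ?_
  refine ((Set.finite_univ (α := E(G))).prod (Set.finite_lt_nat k) |>.image Sum.inr).subset ?_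
  rintro _ ⟨e, j, -, hj, rfl⟩
  exact ⟨(e, j), ⟨trivial, hj⟩, rfl⟩

lemma subdivWeight_nonneg (hw : ∀ e, 0 ≤ w e) (k : ℕ) (f : E(G) × Fin k) :
    0 ≤ G.subdivWeight w k f :=
  div_nonneg (hw _) (Nat.cast_nonneg _)

/-- Numbering of the points of a subdivided edge from either end. -/
def orientedIndex (k : ℕ) (o : Bool) (j : ℕ) : ℕ := bif o then j else k - j

/-- A walk along a stretch of one subdivided edge, numbered from either end. Simplicity is
conditional because the two ends of the edge coincide when it is a loop. -/
lemma exists_segment (w : β → ℝ) (e : E(G)) (o : Bool) (d : ℕ) : ∀ i, i + d ≤ k →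
    ∃ p : (G.subdiv k).Walk (G.subdivPoint k e (orientedIndex k o i))
        (G.subdivPoint k e (orientedIndex k o (i + d))),
      p.length (G.subdivWeight w k) = d * (w e / k) ∧
      (∀ x ∈ p.vertices, ∃ l, i ≤ l ∧ l ≤ i + d ∧ x = G.subdivPoint k e (orientedIndex k o l)) ∧
      ((∀ l l', i ≤ l → l < l' → l' ≤ i + d → G.subdivPoint k e (orientedIndex k o l) ≠
        G.subdivPoint k e (orientedIndex k o l')) → p.vertices.Nodup) := by
  induction d with
  | zero =>
    intro i hi
    refine ⟨.nil (subdivPoint_mem e ?_), by simp, ?_, ?_⟩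
    · cases o <;> simp [orientedIndex]
      simpa using hi
    · intro x hx
      exact ⟨i, le_rfl, le_rfl, by simpa [Walk.vertices] using hx⟩
    · intro _
      simp [Walk.vertices]
  | succ d ih =>
    intro i hi
    obtain ⟨p, hlen, hv, hn⟩ := ih (i + 1) (by omega)
    have hlink : ∃ f : E(G) × Fin k, f.1 = e ∧ (G.subdiv k).IsLink f
        (G.subdivPoint k e (orientedIndex k o i))
        (G.subdivPoint k e (orientedIndex k o (i + 1))) := by
      cases o
      · refine ⟨(e, ⟨k - (i + 1), by omega⟩), rfl, ?_⟩
        have := (G.subdiv_isLink e (j := k - (i + 1)) (k := k) (by omega)).symm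
        rw [show k - (i + 1) + 1 = k - i by omega] at this
        exact this
      · exact ⟨(e, ⟨i, by omega⟩), rfl, G.subdiv_isLink e (j := i) (k := k) (by omega)⟩
    obtain ⟨f, rfl, hf⟩ := hlink
    rw [show i + (d + 1) = i + 1 + d by omega]
    refine ⟨.cons f hf p, ?_, ?_, ?_⟩
    · rw [Walk.length_cons, hlen, subdivWeight]
      push_cast
      ring
    · intro x hx
      simp only [Walk.vertices, List.mem_cons] at hx
      rcases hx with rfl | hx
      · exact ⟨i, le_rfl, by omega, rfl⟩
      · obtain ⟨l, h1, h2, h3⟩ := hv x hx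
        exact ⟨l, by omega, by omega, h3⟩
    · intro h
      simp only [Walk.vertices, List.nodup_cons]
      refine ⟨fun hx => ?_, hn fun l l' h1 h2 h3 => h l l' (by omega) h2 (by omega)⟩
      obtain ⟨l, h1, h2, h3⟩ := hv _ hx
      exact h i l le_rfl (by omega) (by omega) h3

lemma exists_segment_of_eq (w : β → ℝ) (e : E(G)) (o : Bool) {i d j : ℕ} (hj : i + d = j)
    (hjk : j ≤ k) {x y : α ⊕ E(G) × ℕ} (hx : G.subdivPoint k e (orientedIndex k o i) = x)
    (hy : G.subdivPoint k e (orientedIndex k o j) = y) :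
    ∃ p : (G.subdiv k).Walk x y,
      p.length (G.subdivWeight w k) = d * (w e / k) ∧
      (∀ x ∈ p.vertices, ∃ l, i ≤ l ∧ l ≤ j ∧ x = G.subdivPoint k e (orientedIndex k o l)) ∧
      ((∀ l l', i ≤ l → l < l' → l' ≤ j → G.subdivPoint k e (orientedIndex k o l) ≠
        G.subdivPoint k e (orientedIndex k o l')) → p.vertices.Nodup) := by
  subst hx hy hj
  exact exists_segment w e o d i hjk

lemma subdivPoint_orientedIndex (e : E(G)) (o : Bool) {l : ℕ} (hl : 0 < l) (hlk : l < k) :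
    G.subdivPoint k e (orientedIndex k o l) = .inr (e, orientedIndex k o l) := by
  cases o
  · exact G.subdivPoint_of_lt e (by simp [orientedIndex]; omega) (by simp [orientedIndex]; omega)
  · exact G.subdivPoint_of_lt e hl hlk

lemma orientedIndex_injOn (o : Bool) {l l' : ℕ} (hl : l ≤ k) (hl' : l' ≤ k)
    (h : orientedIndex k o l = orientedIndex k o l') : l = l' := by
  cases o <;> simp [orientedIndex] at h <;> omega

/-- The extension of a function on the vertices to the subdivision by given values on the points
of the edges. -/
def subdivPotential (f : α → ℝ) (F : E(G) → ℕ → ℝ) : α ⊕ E(G) × ℕ → ℝ :=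
  Sum.elim f fun x => F x.1 x.2

lemma subdivPotential_subdivPoint {f : α → ℝ} {F : E(G) → ℕ → ℝ}
    (h0 : ∀ e, F e 0 = f (G.src e)) (h1 : ∀ e, F e k = f (G.tgt e)) (e : E(G)) (j : ℕ) :
    subdivPotential f F (G.subdivPoint k e j) = F e j := by
  unfold subdivPoint
  split_ifs with h h'
  · simp [subdivPotential, h, h0]
  · simp [subdivPotential, h', h1]
  · simp [subdivPotential]

lemma subdivPotential_sub_le {f : α → ℝ} {F : E(G) → ℕ → ℝ}
    (h0 : ∀ e, F e 0 = f (G.src e)) (h1 : ∀ e, F e k = f (G.tgt e))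
    (hF : ∀ e, ∀ j < k, |F e (j + 1) - F e j| ≤ w e / k) (a : E(G) × Fin k)
    (x y : α ⊕ E(G) × ℕ) (hxy : (G.subdiv k).IsLink a x y) :
    subdivPotential f F y - subdivPotential f F x ≤ G.subdivWeight w k a := by
  have h := abs_le.1 (hF a.1 a.2 a.2.isLt)
  rcases Sym2.eq_iff.1 hxy with ⟨rfl, rfl⟩ | ⟨rfl, rfl⟩ <;>
    simp only [subdivPotential_subdivPoint h0 h1, subdivWeight] <;> linarith [h.1, h.2]

/-- The point `x` of the subdivision lies on the walk `p` of `G`. -/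
def Walk.Carries {u v : α} (p : G.Walk u v) (x : α ⊕ E(G) × ℕ) : Prop :=
  (∃ a ∈ p.vertices, x = .inl a) ∨ ∃ e : E(G), e.1 ∈ p.edges ∧ ∃ j, x = .inr (e, j)

lemma exists_edge_lift (hk : 0 < k) (w : β → ℝ) {e : β} {u v : α} (he : G.IsLink e u v)
    (huv : u ≠ v) :
    ∃ p : (G.subdiv k).Walk (.inl u) (.inl v), p.vertices.Nodup ∧
      p.length (G.subdivWeight w k) = w e ∧
      ∀ x ∈ p.vertices, x = .inl u ∨ x = .inl v ∨ ∃ f : E(G), f.1 = e ∧ ∃ j, x = .inr (f, j) := by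
  have hk' : (k : ℝ) ≠ 0 := by positivity
  obtain ⟨f, rfl⟩ : ∃ f : E(G), f.1 = e := ⟨⟨e, he.edge_mem⟩, rfl⟩
  have hst := G.isLink_src_tgt f
  have main : ∀ o : Bool, G.subdivPoint k f (orientedIndex k o 0) = .inl u →
      G.subdivPoint k f (orientedIndex k o k) = .inl v →
      ∃ p : (G.subdiv k).Walk (.inl u) (.inl v), p.vertices.Nodup ∧
      p.length (G.subdivWeight w k) = w f ∧
      ∀ x ∈ p.vertices, x = .inl u ∨ x = .inl v ∨ ∃ f' : E(G), f'.1 = f ∧ ∃ j, x = .inr (f', j) := by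
    intro o h0 h1
    obtain ⟨p, hlen, hv, hn⟩ := exists_segment_of_eq w f o (i := 0) (d := k) (zero_add k) le_rfl h0 h1
    have hmid : ∀ l, 0 < l → l < k → G.subdivPoint k f (orientedIndex k o l) =
        .inr (f, orientedIndex k o l) := fun l => subdivPoint_orientedIndex f o
    have hn' := hn (by
      intro l l' _ hl hl'
      rcases Nat.eq_zero_or_pos l with rfl | hl0
      · rw [h0]
        by_cases hlk : l' = k
        · subst hlk
          rw [h1]
          simpa using huv
        · rw [hmid l' (by omega) (by omega)]
          simp
      · rw [hmid l hl0 (by omega)]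
        by_cases hlk : l' = k
        · subst hlk
          rw [h1]
          simp
        · rw [hmid l' (by omega) (by omega)]
          simp only [ne_eq, Sum.inr.injEq, Prod.mk.injEq, true_and]
          exact fun h => hl.ne (orientedIndex_injOn o (by omega) (by omega) h))
    have hx : ∀ x ∈ p.vertices, x = .inl u ∨ x = .inl v ∨
        ∃ f' : E(G), f'.1 = f ∧ ∃ j, x = .inr (f', j) := by
      intro x hx
      obtain ⟨l, -, hl, rfl⟩ := hv x hx
      rcases Nat.eq_zero_or_pos l with rfl | hl0
      · exact Or.inl h0
      · by_cases hlk : l = k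
        · subst hlk
          exact Or.inr (Or.inl h1)
        · exact Or.inr (Or.inr ⟨f, rfl, _, hmid l hl0 (by omega)⟩)
    exact ⟨p, hn', by rw [hlen]; field_simp, hx⟩
  rcases he.eq_and_eq_or_eq_and_eq hst with ⟨rfl, rfl⟩ | ⟨rfl, rfl⟩
  · exact main true (G.subdivPoint_zero k f) (G.subdivPoint_self hk f)
  · exact main false (by simpa [orientedIndex] using G.subdivPoint_self hk f)
      (by simpa [orientedIndex] using G.subdivPoint_zero k f)

lemma Walk.exists_lift (hk : 0 < k) (w : β → ℝ) {u v : α} (p : G.Walk u v)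
    (hp : p.vertices.Nodup) :
    ∃ q : (G.subdiv k).Walk (.inl u) (.inl v), q.vertices.Nodup ∧
      q.length (G.subdivWeight w k) = p.length w ∧ ∀ x ∈ q.vertices, p.Carries x := by
  induction p with
  | @nil u hu =>
    exact ⟨.nil (inl_mem_subdiv hu), by simp [vertices], by simp, fun x hx =>
      Or.inl ⟨u, by simp [vertices], by simpa [vertices] using hx⟩⟩
  | @cons u y v e he p ih =>
    have hed := (Walk.cons e he p).edges_nodup hp
    simp only [vertices, List.nodup_cons, edges] at hp hed
    obtain ⟨q, hq, hlen, hc⟩ := ih hp.2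
    have huy : u ≠ y := fun h => hp.1 (h ▸ p.start_mem_vertices)
    obtain ⟨a, ha, hla, hca⟩ := exists_edge_lift hk w he huy
    refine ⟨a.append q, nodup_append a q ha hq ?_, by simp [hla, hlen], ?_⟩
    · intro x hx hxq
      rcases hca x hx with rfl | rfl | ⟨f, hf, j, rfl⟩
      · rcases hc _ hxq with ⟨b, hb, hxb⟩ | ⟨f, -, j, hxb⟩
        · cases hxb
          exact absurd hb hp.1
        · cases hxb
      · rfl
      · rcases hc _ hxq with ⟨b, hb, hxb⟩ | ⟨f', hf', j', hxb⟩
        · cases hxb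
        · cases hxb
          exact absurd (hf ▸ hf') hed.1
    · intro x hx
      rcases (mem_vertices_append _ _).1 hx with hx | hx
      · rcases hca x hx with rfl | rfl | ⟨f, hf, j, rfl⟩
        · exact Or.inl ⟨_, by simp [vertices], rfl⟩
        · exact Or.inl ⟨_, by simp [vertices, start_mem_vertices], rfl⟩
        · exact Or.inr ⟨f, by simp [edges, hf], j, rfl⟩
      · rcases hc x hx with ⟨b, hb, hxb⟩ | ⟨f, hf, j, hxb⟩
        · exact Or.inl ⟨b, by simp [vertices, hb], hxb⟩
        · exact Or.inr ⟨f, by simp [edges, hf], j, hxb⟩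

/-- Shortest paths lift to shortest paths of the subdivision. -/
lemma Walk.IsShortestPath.exists_lift (hw : ∀ e, 0 ≤ w e) (hk : 0 < k) {u v : α}
    {p : G.Walk u v} (hp : p.IsShortestPath w) :
    ∃ q : (G.subdiv k).Walk (.inl u) (.inl v), q.IsShortestPath (G.subdivWeight w k) ∧
      q.length (G.subdivWeight w k) = p.length w ∧ ∀ x ∈ q.vertices, p.Carries x := by
  obtain ⟨q, hq, hlen, hc⟩ := p.exists_lift hk w hp.1
  have hk' : (0 : ℝ) < k := by exact_mod_cast hk
  refine ⟨q, ?_, hlen, hc⟩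
  -- The distance from `u` extended to the points of an edge: such a point is reached through one
  -- end or the other.
  let F : E(G) → ℕ → ℝ := fun e j =>
    min (G.wdist w u (G.src e) + j * (w e / k)) (G.wdist w u (G.tgt e) + (k - j) * (w e / k))
  have hkw : ∀ e : E(G), (k : ℝ) * (w e / k) = w e := fun e => by field_simp
  refine isShortestPath_of_potential (f := subdivPotential (G.wdist w u) F)
    (subdivPotential_sub_le ?_ ?_ ?_) q hq ?_
  · intro e
    have := wdist_sub_le hw u e _ _ (G.isLink_src_tgt e).symm
    simp only [F, Nat.cast_zero, zero_mul, sub_zero, hkw, add_zero]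
    exact min_eq_left (by linarith)
  · intro e
    have := wdist_sub_le hw u e _ _ (G.isLink_src_tgt e)
    simp only [F, sub_self, zero_mul, hkw, add_zero]
    exact min_eq_right (by linarith)
  · intro e j hj
    have hc : 0 ≤ w e / k := div_nonneg (hw _) hk'.le
    simp only [F]
    refine (abs_min_sub_min_le_max _ _ _ _).trans (max_le ?_ ?_)
    · push_cast
      rw [abs_le]
      constructor <;> linarith
    · push_cast
      rw [abs_le]
      constructor <;> linarith
  · have h0 := wdist_self hw p.left_mem
    simp [subdivPotential, hlen, hp.length_eq hw, h0]

lemma wdist_subdiv_le [Finite β] (hw : ∀ e, 0 ≤ w e) (hk : 0 < k) {u v : α}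
    (h : G.Reachable u v) :
    (G.subdiv k).Reachable (.inl u) (.inl v) ∧
      (G.subdiv k).wdist (G.subdivWeight w k) (.inl u) (.inl v) ≤ G.wdist w u v := by
  obtain ⟨p, hp⟩ := h.elim fun p => p.exists_isShortestPath hw
  obtain ⟨q, hq, hlen, -⟩ := hp.exists_lift hw hk
  exact ⟨⟨q⟩, (wdist_le_length (subdivWeight_nonneg hw k) q).trans
    (hlen.trans (hp.length_eq hw)).le⟩

/-! ### Degrees and hubs -/

/-- In a subdivision with highway bound `h`, at most `h / 2` edges of positive weight leave the
set of points at distance zero from a vertex. -/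
lemma two_mul_card_le_of_highwayBound [Finite β] (hw : ∀ e, 0 ≤ w e) (hk : 0 < k) {h : ℕ}
    (hb : (G.subdiv k).HighwayBound (G.subdivWeight w k) h) {r : ℝ} (hr : 0 < r)
    (hkr : ∀ e, w e / k ≤ r / 4) {v : α} (hv : v ∈ V(G)) (D : Finset E(G))
    (hD : ∀ e ∈ D, 16 * r ≤ w e ∧
      ∃ a, G.Reachable v a ∧ G.wdist w v a ≤ 0 ∧ (a = G.src e ∨ a = G.tgt e)) :
    2 * D.card ≤ h := by
  classical
  have hk' : (0 : ℝ) < k := by exact_mod_cast hk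
  have hω := subdivWeight_nonneg (G := G) hw k
  obtain ⟨S, hS, hcard, hhit⟩ := hb r hr _ (inl_mem_subdiv hv)
  -- On each edge, the segments with indices `1, …, 1 + J` and `2 + J, …, 2 + 2 * J`, counted from
  -- the end near `v`, are disjoint and avoid the vertices of `G`. Each is a shortest path longer
  -- than `r` inside the ball, so each contains a hub.
  have key : ∀ e ∈ D, ∃ (o : Bool) (J : ℕ), 2 * (2 * J + 2) < k ∧
      ∀ b : Bool, ∃ l, (bif b then 2 + J else 1) ≤ l ∧ l ≤ (bif b then 2 + J else 1) + J ∧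
        (.inr (e, orientedIndex k o l) : α ⊕ E(G) × ℕ) ∈ S := by
    intro e he
    obtain ⟨hre, a, hva, hda, ha⟩ := hD e he
    obtain ⟨o, ho⟩ : ∃ o, G.subdivPoint k e (orientedIndex k o 0) = .inl a := by
      rcases ha with rfl | rfl
      · exact ⟨true, G.subdivPoint_zero k e⟩
      · exact ⟨false, by simpa [orientedIndex] using G.subdivPoint_self hk e⟩
    set c : ℝ := w e / k with hc
    have hcpos : 0 < c := div_pos (by linarith) hk'
    have hkc : (k : ℝ) * c = w e := by rw [hc]; field_simp
    have hcr : c ≤ r / 4 := hkr e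
    -- `J` pieces are just longer than `r`. As `c ≤ r / 4`, both segments end within `3 * r` of the
    -- near end, and hence in the first half of an edge of weight at least `16 * r`.
    obtain ⟨J, hJ1, hJ2⟩ : ∃ J : ℕ, r < J * c ∧ J * c ≤ r + c := by
      refine ⟨⌊r / c⌋₊ + 1, ?_, ?_⟩
      · have := Nat.lt_floor_add_one (r / c)
        rw [div_lt_iff₀ hcpos] at this
        exact_mod_cast this
      · have := Nat.floor_le (div_nonneg hr.le hcpos.le)
        rw [le_div_iff₀ hcpos] at this
        push_cast
        linarith
    have hJk : 2 * (2 * J + 2) < k := by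
      have : (2 * (2 * J + 2) : ℝ) * c < k * c := by
        rw [hkc]
        nlinarith
      exact_mod_cast lt_of_mul_lt_mul_right this hcpos.le
    refine ⟨o, J, hJk, fun b => ?_⟩
    have hball : ∀ l, 0 < l → l ≤ 2 * J + 2 → (.inr (e, orientedIndex k o l) : α ⊕ E(G) × ℕ) ∈
        (G.subdiv k).wball (G.subdivWeight w k) (.inl v) (4 * r) := by
      intro l hl hlJ
      obtain ⟨p, hlen, -, -⟩ := exists_segment_of_eq w e o (i := 0) (d := l) (zero_add l) (by omega) ho
        (subdivPoint_orientedIndex e o hl (by omega))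
      obtain ⟨hr1, hd1⟩ := wdist_subdiv_le (k := k) hw hk hva
      refine ⟨hr1.trans ⟨p⟩, (wdist_triangle hω hr1 ⟨p⟩).trans ?_⟩
      have h1 := wdist_le_length hω p
      have h2 : (l : ℝ) * c ≤ (2 * J + 2) * c :=
        mul_le_mul_of_nonneg_right (by exact_mod_cast hlJ) hcpos.le
      rw [hlen] at h1
      nlinarith
    set i : ℕ := bif b then 2 + J else 1 with hi
    have hi0 : 0 < i ∧ i + J ≤ 2 * J + 2 := by
      cases b
      · simp only [hi, cond_false]
        omega
      · simp only [hi, cond_true]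
        omega
    have hpt : ∀ l, i ≤ l → l ≤ i + J → G.subdivPoint k e (orientedIndex k o l) =
        .inr (e, orientedIndex k o l) := fun l h1 h2 =>
      subdivPoint_orientedIndex e o (by omega) (by omega)
    obtain ⟨p, hlen, hpv, hn⟩ := exists_segment_of_eq w e o (i := i) (d := J) rfl (by omega)
      (hpt i le_rfl (by omega)) (hpt (i + J) (by omega) le_rfl)
    have hnodup := hn (by
      intro l l' h1 h2 h3 heq
      rw [hpt l h1 (by omega), hpt l' (by omega) h3] at heq
      simp only [Sum.inr.injEq, Prod.mk.injEq, true_and] at heq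
      exact h2.ne (orientedIndex_injOn o (by omega) (by omega) heq))
    have hin : ∀ x ∈ p.vertices, x ∈
        (G.subdiv k).wball (G.subdivWeight w k) (.inl v) (4 * r) := by
      intro x hx
      obtain ⟨l, h1, h2, rfl⟩ := hpv x hx
      rw [hpt l h1 h2]
      exact hball l (by omega) (by omega)
    -- The distance to the nearer end of the edge, zero at all vertices of `G`. It grows at full
    -- rate on the first half, so it certifies the segments as shortest.
    let F : E(G) → ℕ → ℝ := fun e j => min (j * (w e / k)) ((k - j) * (w e / k))
    have hF : ∀ l, l ≤ 2 * J + 2 → F e (orientedIndex k o l) = l * c := by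
      intro l hl
      have h1 : (l : ℝ) * c ≤ (k - l) * c := by
        refine mul_le_mul_of_nonneg_right ?_ hcpos.le
        rw [le_sub_iff_add_le]
        exact_mod_cast (by omega : l + l ≤ k)
      cases o
      · simp only [F, orientedIndex, cond_false]
        rw [Nat.cast_sub (by omega)]
        rw [sub_sub_cancel, min_comm]
        exact min_eq_left h1
      · exact min_eq_left h1
    have hshort : p.IsShortestPath (G.subdivWeight w k) := by
      refine Walk.isShortestPath_of_potential (f := subdivPotential (fun _ => 0) F)
        (subdivPotential_sub_le ?_ ?_ ?_) p hnodup ?_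
      · intro e
        have : 0 ≤ (k : ℝ) * (w e / k) := mul_nonneg hk'.le (div_nonneg (hw _) hk'.le)
        simpa [F] using this
      · intro e
        have : 0 ≤ (k : ℝ) * (w e / k) := mul_nonneg hk'.le (div_nonneg (hw _) hk'.le)
        simpa [F] using this
      · intro e j hj
        have hc : 0 ≤ w e / k := div_nonneg (hw _) hk'.le
        refine (abs_min_sub_min_le_max _ _ _ _).trans (max_le ?_ ?_) <;>
        · push_cast
          rw [abs_le]
          constructor <;> linarith
      · simp only [subdivPotential, Sum.elim_inr]
        rw [hF _ hi0.2, hF _ (by omega), hlen]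
        push_cast
        linarith
    obtain ⟨x, hx, hxS⟩ := hhit _ (hin _ p.start_mem_vertices) _ (hin _ p.end_mem_vertices) p
      hshort (by rw [hlen]; exact hJ1) hin
    obtain ⟨l, h1, h2, rfl⟩ := hpv x hx
    rw [hpt l h1 h2] at hxS
    exact ⟨l, h1, h2, hxS⟩
  choose! o J hJ l hl1 hl2 hlS using key
  have hle : (D ×ˢ (Finset.univ : Finset Bool)).card ≤ S.card := by
    refine Finset.card_le_card_of_injOn
      (fun x => .inr (x.1, orientedIndex k (o x.1) (l x.1 x.2))) ?_ ?_
    · rintro ⟨e, b⟩ he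
      simp only [Finset.coe_product, Set.mem_prod, Finset.mem_coe] at he
      exact hlS e he.1 b
    · rintro ⟨e, b⟩ he ⟨e', b'⟩ he' heq
      simp only [Finset.coe_product, Set.mem_prod, Finset.mem_coe] at he he'
      simp only [Sum.inr.injEq, Prod.mk.injEq] at heq
      obtain ⟨rfl, heq⟩ := heq
      have b1 := hl1 e he.1 b
      have b2 := hl2 e he.1 b
      have b3 := hl1 e he.1 b'
      have b4 := hl2 e he.1 b'
      have hJe := hJ e he.1
      have : l e b = l e b' := by
        refine orientedIndex_injOn (k := k) (o e) ?_ ?_ heq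
        · cases b <;> simp at b2 <;> omega
        · cases b' <;> simp at b4 <;> omega
      cases b <;> cases b' <;> simp only [cond_true, cond_false] at b1 b2 b3 b4 <;>
        first | rfl | (exfalso; omega)
  rw [Finset.card_product, Finset.card_univ, Fintype.card_bool] at hle
  omega

/-- A positive shortest path that meets a vertex has a positive edge with an end at distance zero
from that vertex. -/
lemma Walk.IsShortestPath.exists_pos_edge (hw : ∀ e, 0 ≤ w e) {u v a : α} {p : G.Walk u v}
    (hp : p.IsShortestPath w) (hpos : 0 < p.length w) (ha : a ∈ p.vertices) :
    ∃ e ∈ p.edges, 0 < w e ∧ ∃ x y, G.IsLink e x y ∧ G.Reachable a x ∧ G.wdist w a x ≤ 0 := by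
  by_contra! hcon
  obtain ⟨ha1, ha2, -, -⟩ := p.wdist_le_of_mem hw ha
  -- If no positive edge of `p` has an end in `Z`, then `p` never crosses the boundary of `Z`, both
  -- its ends lie in `Z`, and its length is zero.
  let Z : Set α := {x | G.Reachable a x ∧ G.wdist w a x ≤ 0}
  have hmem : ∀ x ∈ p.vertices, x ∈ Z ↔ u ∈ Z := fun x hx =>
    p.mem_iff_of_no_boundary_edge Z (fun e he x y hxy hx => by
      have h0 : w e ≤ 0 := by
        by_contra! h0
        exact absurd hx.2 (not_le.2 (hcon e he h0 x y hxy hx.1))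
      refine ⟨hx.1.trans hxy.reachable, ?_⟩
      have := wdist_sub_le hw a e x y hxy
      linarith [hx.2]) hx
  have haZ : a ∈ Z := ⟨⟨.nil (ha1.elim fun p => p.right_mem)⟩,
    (wdist_self hw (ha1.elim fun p => p.right_mem)).le⟩
  have huZ : u ∈ Z := (hmem a ha).1 haZ
  have hvZ : v ∈ Z := (hmem v p.end_mem_vertices).2 huZ
  have := wdist_triangle hw huZ.1.symm hvZ.1
  rw [wdist_comm hw u a, ← hp.length_eq hw] at this
  linarith [huZ.2, hvZ.2]

/-- Every point of the subdivision has at most `h` edges such that each positive shortest path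
through the point uses one of them. -/
lemma exists_hub_edges [Finite β] (hw : ∀ e, 0 ≤ w e) (hk : 0 < k) {h : ℕ}
    (hb : (G.subdiv k).HighwayBound (G.subdivWeight w k) h) {r : ℝ} (hr : 0 < r)
    (hkr : ∀ e, w e / k ≤ r / 4) (hmin : ∀ e, 0 < w e → 16 * r ≤ w e) (x : α ⊕ E(G) × ℕ) :
    ∃ N : Finset E(G), N.card ≤ h ∧ ∀ (u v : α) (p : G.Walk u v), p.IsShortestPath w →
      0 < p.length w → p.Carries x → ∃ e ∈ N, e.1 ∈ p.edges := by
  classical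
  have := Fintype.ofFinite E(G)
  have main : ∀ a : α, ∃ N : Finset E(G), N.card ≤ h ∧
      ∀ (u v : α) (p : G.Walk u v), p.IsShortestPath w → 0 < p.length w → a ∈ p.vertices →
        ∃ e ∈ N, e.1 ∈ p.edges := by
    intro a
    by_cases ha : a ∈ V(G)
    · refine ⟨Finset.univ.filter fun e : E(G) => 0 < w e ∧
        ∃ b, G.Reachable a b ∧ G.wdist w a b ≤ 0 ∧ (b = G.src e ∨ b = G.tgt e), ?_, ?_⟩
      · have := two_mul_card_le_of_highwayBound hw hk hb hr hkr ha (Finset.univ.filter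
          fun e : E(G) => 0 < w e ∧
            ∃ b, G.Reachable a b ∧ G.wdist w a b ≤ 0 ∧ (b = G.src e ∨ b = G.tgt e))
          (fun e he => by
            rw [Finset.mem_filter] at he
            exact ⟨hmin e he.2.1, he.2.2⟩)
        omega
      · intro u v p hp hpos hap
        obtain ⟨e, he, he0, y, z, hyz, hay, hd⟩ := hp.exists_pos_edge hw hpos hap
        refine ⟨⟨e, hyz.edge_mem⟩, by
          simp only [Finset.mem_filter, Finset.mem_univ, true_and]
          refine ⟨he0, y, hay, hd, ?_⟩
          rcases hyz.eq_and_eq_or_eq_and_eq (G.isLink_src_tgt ⟨e, hyz.edge_mem⟩) with h | h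
          · exact Or.inl h.1
          · exact Or.inr h.1, he⟩
    · refine ⟨∅, by simp, fun u v p _ _ hap => absurd ?_ ha⟩
      obtain ⟨p₁, -, -⟩ := p.exists_eq_append_of_mem hap
      exact p₁.right_mem
  rcases x with a | ⟨e, j⟩
  · obtain ⟨N, hN, hN'⟩ := main a
    refine ⟨N, hN, fun u v p hp hpos hc => hN' u v p hp hpos ?_⟩
    rcases hc with ⟨b, hb, hab⟩ | ⟨e, -, j, hab⟩
    · cases hab
      exact hb
    · cases hab
  -- A walk carrying an inner point of `e` uses `e`. If `w e > 0`, this edge alone suffices, and the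
  -- degree bound gives `1 ≤ h`. Otherwise the end `G.src e` takes the place of the point.
  · by_cases he : 0 < w e
    · refine ⟨{e}, ?_, fun u v p hp hpos hc => ⟨e, by simp, ?_⟩⟩
      · have hs := (G.isLink_src_tgt e).left_mem
        have := two_mul_card_le_of_highwayBound hw hk hb hr hkr hs {e} (by
          intro f hf
          rw [Finset.mem_singleton] at hf
          subst hf
          exact ⟨hmin _ he, _, ⟨.nil hs⟩, (wdist_self hw hs).le, Or.inl rfl⟩)
        rw [Finset.card_singleton] at this ⊢
        omega
      · rcases hc with ⟨b, hb, hab⟩ | ⟨f, hf, j, hab⟩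
        · cases hab
        · cases hab
          exact hf
    · obtain ⟨N, hN, hN'⟩ := main (G.src e)
      refine ⟨N, hN, fun u v p hp hpos hc => hN' u v p hp hpos ?_⟩
      rcases hc with ⟨b, hb, hab⟩ | ⟨f, hf, j, hab⟩
      · cases hab
      · cases hab
        exact (p.mem_vertices_of_isLink hf (G.isLink_src_tgt e)).1

/-! ### Counting long shortest paths near a vertex -/

/-- A shortest path contains at most as much weight of the edges inside a vertex set as its part
after the first visit. -/
lemma Walk.sum_induce_le [Fintype β] (hw : ∀ e, 0 ≤ w e) {u v : α} (p : G.Walk u v) (B : Set α)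
    (A : Finset β) (hA : ∀ e ∈ A, e ∈ E(G.induce B) ∧ e ∈ p.edges) (hpos : 0 < ∑ e ∈ A, w e)
    (hp : p.IsShortestPath w) :
    ∃ y ∈ B, ∃ q : G.Walk y v, q.IsShortestPath w ∧ (∀ e ∈ q.edges, e ∈ p.edges) ∧
      ∑ e ∈ A, w e ≤ q.length w := by
  classical
  obtain ⟨e, heA⟩ : A.Nonempty := by
    rw [Finset.nonempty_iff_ne_empty]
    rintro rfl
    simp at hpos
  obtain ⟨⟨a, b, hab, ha, hb⟩, hep⟩ := hA e heA
  obtain ⟨y, hy, p₁, p₂, rfl, h⟩ :=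
    p.exists_first_mem B ⟨a, (p.mem_vertices_of_isLink hep hab).1, ha⟩
  refine ⟨y, hy, p₂, hp.right, fun e he => by simp [he], ?_⟩
  have hsub : A ⊆ p₂.edges.toFinset := by
    intro f hf
    obtain ⟨⟨a, b, hab, ha, hb⟩, hfp⟩ := hA f hf
    exact List.mem_toFinset.2 (h f hfp a b hab ha hb)
  refine (Finset.sum_le_sum_of_subset_of_nonneg hsub fun e _ _ => hw e).trans (le_of_eq ?_)
  exact List.sum_toFinset w (p₂.edges_nodup hp.right.1)

/-- The number of shortest paths, at most `ℓ` through each edge, that have length more than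
`R / 2 ^ (J + 1)` inside a ball of radius `R`. -/
lemma card_le_of_highwayBound [Fintype β] (hw : ∀ e, 0 ≤ w e) (hk : 0 < k) {h : ℕ}
    (hb : (G.subdiv k).HighwayBound (G.subdivWeight w k) h) {r : ℝ} (hr : 0 < r)
    (hkr : ∀ e, w e / k ≤ r / 4) (hmin : ∀ e, 0 < w e → 16 * r ≤ w e)
    {R : ℝ} (hR : 0 < R) {J : ℕ} (hkR : ∀ e, w e / k ≤ R / 2 ^ (J + 1)) {s : α} (hs : s ∈ V(G))
    {ι : Type*} [Finite ι] (I : Finset ι) (C : ι → Set β) (A : ι → Finset β)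
    (hC : ∀ i ∈ I, G.IsShortestPathEdgeSet w (C i))
    (hA : ∀ i ∈ I, ∀ e ∈ A i, e ∈ E(G.induce (G.wball w s R)) ∧ e ∈ C i)
    (hsum : ∀ i ∈ I, R / 2 ^ (J + 1) < ∑ e ∈ A i, w e) {ℓ : ℕ}
    (hℓ : ∀ e ∈ E(G), {i | e ∈ C i}.ncard ≤ ℓ) :
    I.card ≤ (h + 1) ^ J * (h * (h * ℓ)) ∧ (I.Nonempty → 2 ≤ h) := by
  classical
  have := Fintype.ofFinite ι
  have hω := subdivWeight_nonneg (G := G) hw k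
  have hρ : 0 < R / 2 ^ (J + 1) := by positivity
  have hη : ∀ f, G.subdivWeight w k f ≤ R / 2 ^ (J + 1) := fun f => hkR _
  obtain ⟨T, hT, hTcard, hTcov⟩ :=
    hb.exists_cover_iterate hω hR hη (inl_mem_subdiv hs) J le_rfl
  choose! S hS hScard hShit using fun c (hc : c ∈ T) => hb (R / 2 ^ (J + 1)) hρ c (hT hc)
  choose N hNcard hN using exists_hub_edges hw hk hb hr hkr hmin
  -- With `r' = R / 2 ^ (J + 1)`, the lifted path starts within `2 * r'` of a center `c`, and its
  -- prefix has length between `r'` and `2 * r'`. The prefix therefore stays within `4 * r'` of `c`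
  -- and meets `S c`.
  have key : ∀ i ∈ I, ∃ c ∈ T, ∃ x ∈ S c, ∃ e ∈ N x, e.1 ∈ C i := by
    intro i hi
    obtain ⟨u, v, p, hp, hpC⟩ := hC i hi
    obtain ⟨y, hy, q, hq, hqp, hle⟩ := p.sum_induce_le hw (G.wball w s R) (A i)
      (fun e he => ⟨(hA i hi e he).1, by have := (hA i hi e he).2; rw [← hpC] at this; exact this⟩)
      (hρ.trans (hsum i hi)) hp
    obtain ⟨q', hq', hlen, hcar⟩ := hq.exists_lift (k := k) hw hk
    have hlt : R / 2 ^ (J + 1) < q'.length (G.subdivWeight w k) := by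
      rw [hlen]
      exact (hsum i hi).trans_le hle
    obtain ⟨z, p₁, p₂, rfl, h1, h2⟩ := q'.exists_prefix hη _ hρ.le hlt
    obtain ⟨hr1, hd1⟩ := wdist_subdiv_le (k := k) hw hk hy.1
    obtain ⟨c, hc, hyc⟩ := hTcov (.inl y) ⟨hr1, hd1.trans hy.2⟩
    have e1 : R / 2 ^ J = 2 * (R / 2 ^ (J + 1)) := by field_simp; ring
    have hin : ∀ x ∈ p₁.vertices, x ∈
        (G.subdiv k).wball (G.subdivWeight w k) c (4 * (R / 2 ^ (J + 1))) := by
      intro x hx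
      obtain ⟨h3, -, h4, -⟩ := p₁.wdist_le_of_mem hω hx
      refine ⟨hyc.1.trans h3, (wdist_triangle hω hyc.1 h3).trans ?_⟩
      have := hyc.2
      linarith
    obtain ⟨x, hx, hxS⟩ := hShit c hc _ (hin _ p₁.start_mem_vertices) _
      (hin _ p₁.end_mem_vertices) p₁ hq'.left h1 hin
    obtain ⟨e, he, heq⟩ := hN x y v q hq (by rw [← hlen]; linarith)
      (hcar x ((p₁.mem_vertices_append p₂).2 (Or.inl hx)))
    refine ⟨c, hc, x, hxS, e, he, ?_⟩
    rw [← hpC]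
    exact hqp _ heq
  constructor
  · have hsub : I ⊆ T.biUnion fun c => (S c).biUnion fun x => (N x).biUnion fun e =>
        {i | e.1 ∈ C i}.toFinset := by
      intro i hi
      obtain ⟨c, hc, x, hx, e, he, h⟩ := key i hi
      simp only [Finset.mem_biUnion, Set.mem_toFinset]
      exact ⟨c, hc, x, hx, e, he, h⟩
    refine (Finset.card_le_card hsub).trans
      ((Finset.card_biUnion_le_card_mul _ _ (h * (h * ℓ)) fun c hc => ?_).trans
        (Nat.mul_le_mul_right _ hTcard))
    refine (Finset.card_biUnion_le_card_mul _ _ (h * ℓ) fun x hx => ?_).trans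
        (Nat.mul_le_mul_right _ (hScard c hc))
    refine (Finset.card_biUnion_le_card_mul _ _ ℓ fun e he => ?_).trans
        (Nat.mul_le_mul_right _ (hNcard x))
    rw [← Set.ncard_eq_toFinset_card']
    exact hℓ e e.2
  · rintro ⟨i, hi⟩
    obtain ⟨e, heA, he⟩ : ∃ e ∈ A i, 0 < w e := by
      by_contra! hcon
      exact absurd ((hρ.trans (hsum i hi))) (not_lt.2 (Finset.sum_nonpos hcon))
    have heG : e ∈ E(G) := by
      obtain ⟨a, b, hab, -, -⟩ := (hA i hi e heA).1
      exact hab.edge_mem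
    have hsrc := (G.isLink_src_tgt ⟨e, heG⟩).left_mem
    -- A single positive edge already needs two hubs.
    have := two_mul_card_le_of_highwayBound hw hk hb hr hkr hsrc {⟨e, heG⟩} (by
      intro f hf
      rw [Finset.mem_singleton] at hf
      subst hf
      exact ⟨hmin _ he, _, ⟨.nil hsrc⟩, (wdist_self hw hsrc).le, Or.inl rfl⟩)
    simpa using this

/-- The same bound in a graph of continuous highway dimension `h`. -/
lemma HasContinuousHighwayDim.card_le [Finite α] [Fintype β] (hw : ∀ e, 0 ≤ w e) {h : ℕ}
    (hh : G.HasContinuousHighwayDim w h) {R : ℝ} (hR : 0 < R) {J : ℕ} {s : α} (hs : s ∈ V(G))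
    {ι : Type*} [Finite ι] (I : Finset ι) (C : ι → Set β) (A : ι → Finset β)
    (hC : ∀ i ∈ I, G.IsShortestPathEdgeSet w (C i))
    (hA : ∀ i ∈ I, ∀ e ∈ A i, e ∈ E(G.induce (G.wball w s R)) ∧ e ∈ C i)
    (hsum : ∀ i ∈ I, R / 2 ^ (J + 1) < ∑ e ∈ A i, w e) {ℓ : ℕ}
    (hℓ : ∀ e ∈ E(G), {i | e ∈ C i}.ncard ≤ ℓ) :
    I.card ≤ (h + 1) ^ J * (h * (h * ℓ)) ∧ (I.Nonempty → 2 ≤ h) := by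
  classical
  obtain ⟨r, hr, hmin⟩ : ∃ r : ℝ, 0 < r ∧ ∀ e, 0 < w e → 16 * r ≤ w e := by
    have hev : ∀ᶠ r : ℝ in 𝓝[>] 0, ∀ e, 0 < w e → 16 * r ≤ w e := by
      refine eventually_all.2 fun e => ?_
      by_cases he : 0 < w e
      · filter_upwards [Ioo_mem_nhdsGT (show (0 : ℝ) < w e / 16 by positivity)] with r hr _
        linarith [hr.2]
      · exact Eventually.of_forall fun r h => absurd h he
    obtain ⟨r, h1, h2⟩ := (hev.and self_mem_nhdsWithin).exists
    exact ⟨r, h2, h1⟩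
  have hsmall : ∀ a : ℝ, 0 < a → ∀ᶠ k : ℕ in atTop, ∀ e, w e / k ≤ a := fun a ha =>
    eventually_all.2 fun e =>
      ((tendsto_const_div_atTop_nhds_zero_nat (w e)).eventually_lt_const ha).mono fun k hk => hk.le
  -- Convergence in the discrete space `ℕ` means eventual equality.
  have hdim : ∀ᶠ k : ℕ in atTop, (G.subdiv k).highwayDim (G.subdivWeight w k) = h := by
    have := hh.eventually (by simp [nhds_discrete] : ∀ᶠ x in 𝓝 h, x = h)
    exact this
  obtain ⟨k, hk, hdim, h1, h2⟩ := ((eventually_gt_atTop 0).and (hdim.and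
    ((hsmall (r / 4) (by positivity)).and (hsmall (R / 2 ^ (J + 1)) (by positivity))))).exists
  have hb := highwayBound_highwayDim (w := G.subdivWeight w k)
    (subdiv_vertexSet_finite (G := G) (k := k))
  rw [hdim] at hb
  exact card_le_of_highwayBound hw hk hb hr h1 hmin hR h2 hs I C A hC hA hsum hℓ

end Graph

/-! ### Concentration on the hypercube -/

/-- Talagrand's calculus inequality: some `θ` in `[0, 1]` gives exp(θ²/8) r^(θ-1) ≤ 2 - r. The
choice is `θ = 1` for `r ≤ 1 / 2` and `θ = 2 * (1 - r)`, which vanishes at `r = 1`, for larger `r`.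
-/
lemma exists_exponent_bound {r : ℝ} (hr : 0 < r) (hr1 : r ≤ 1) :
    ∃ θ : ℝ, 0 ≤ θ ∧ θ ≤ 1 ∧ θ ^ 2 / 8 + θ * Real.log r ≤ Real.log r + Real.log (2 - r) := by
  rcases le_total r (1 / 2) with h | h
  · refine ⟨1, zero_le_one, le_rfl, ?_⟩
    have h1 := Real.one_sub_inv_le_log_of_pos (show (0 : ℝ) < 2 - r by linarith)
    have h2 : (2 - r)⁻¹ ≤ 2 / 3 := by
      rw [inv_le_comm₀ (by linarith) (by norm_num)]
      linarith
    linarith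
  · refine ⟨2 * (1 - r), by linarith, by linarith, ?_⟩
    have h1 := Real.one_sub_inv_le_log_of_pos hr
    have h2 := Real.le_log_one_add_of_nonneg (show (0 : ℝ) ≤ 1 - r by linarith)
    rw [show 1 + (1 - r) = 2 - r by ring] at h2
    have h3 : (1 - 2 * (1 - r)) * (1 - r⁻¹) ≤ (1 - 2 * (1 - r)) * Real.log r :=
      mul_le_mul_of_nonneg_left h1 (by linarith)
    have h4 : (2 * (1 - r)) ^ 2 / 8 ≤ 2 * (1 - r) / (1 - r + 2) +
        (1 - 2 * (1 - r)) * (1 - r⁻¹) := by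
      have ha : (1 - r) * (1 - (1 - r) / 2) ≤ 2 * (1 - r) / (1 - r + 2) := by
        rw [le_div_iff₀ (by linarith)]
        nlinarith [pow_nonneg (show (0 : ℝ) ≤ 1 - r by linarith) 3]
      have hb : -((1 - r) * r) ≤ (1 - 2 * (1 - r)) * (1 - r⁻¹) := by
        have e : (1 - 2 * (1 - r)) * (1 - r⁻¹) = -((1 - r) * (2 * r - 1)) / r := by
          field_simp
          ring
        rw [e, le_div_iff₀ hr]
        nlinarith [mul_nonneg (show (0 : ℝ) ≤ 1 - r by linarith) (sq_nonneg (1 - r))]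
      nlinarith
    nlinarith

lemma sum_exp_convex_comb_le {ι : Type*} [Fintype ι] (φ ψ : ι → ℝ) {θ : ℝ} (h0 : 0 ≤ θ)
    (h1 : θ ≤ 1) :
    ∑ i, Real.exp ((1 - θ) * φ i + θ * ψ i) ≤
      (∑ i, Real.exp (φ i)) ^ (1 - θ) * (∑ i, Real.exp (ψ i)) ^ θ := by
  -- Hölder with exponents 1/(1-θ) and 1/θ, which needs `θ` strictly between 0 and 1.
  rcases h0.eq_or_lt with rfl | h0
  · simp
  rcases h1.eq_or_lt with rfl | h1
  · simp
  have h := Real.inner_le_Lp_mul_Lq_of_nonneg Finset.univ (p := (1 - θ)⁻¹) (q := θ⁻¹)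
    (f := fun i => Real.exp ((1 - θ) * φ i)) (g := fun i => Real.exp (θ * ψ i))
    ((Real.holderConjugate_iff).2 ⟨by
      rw [one_lt_inv₀ (by linarith)]; linarith, by simp⟩)
    (fun i _ => (Real.exp_pos _).le) (fun i _ => (Real.exp_pos _).le)
  have e1 : ∀ x : ℝ, Real.exp ((1 - θ) * x) ^ (1 - θ)⁻¹ = Real.exp x := fun x => by
    rw [← Real.exp_mul]
    congr 1
    have : 1 - θ ≠ 0 := by linarith
    field_simp
  have e2 : ∀ x : ℝ, Real.exp (θ * x) ^ θ⁻¹ = Real.exp x := fun x => by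
    rw [← Real.exp_mul]
    congr 1
    field_simp
  simp only [e1, e2, one_div, inv_inv, ← Real.exp_add] at h
  exact h

/-- With r = b/a, the preceding bound reduces this to (3 - r)(1 + r) = 4 - (1 - r)² ≤ 4. Here `a`
and `b` stand for the exponential sums over two halves of a cube. -/
lemma exists_exponents {a b : ℝ} (hb : 0 < b) (hab : b ≤ a) :
    ∃ θ : ℝ, 0 ≤ θ ∧ θ ≤ 1 ∧
      (a⁻¹ + Real.exp (θ ^ 2 / 8) * (b⁻¹ ^ (1 - θ) * a⁻¹ ^ θ)) * (a + b) ≤ 4 := by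
  have ha : 0 < a := hb.trans_le hab
  obtain ⟨θ, h0, h1, h⟩ := exists_exponent_bound (div_pos hb ha) ((div_le_one ha).2 hab)
  refine ⟨θ, h0, h1, ?_⟩
  have hr : 0 < 2 - b / a := by
    have := (div_le_one ha).2 hab
    linarith
  have key : Real.exp (θ ^ 2 / 8) * (b⁻¹ ^ (1 - θ) * a⁻¹ ^ θ) ≤ a⁻¹ * (2 - b / a) := by
    rw [← Real.exp_log (mul_pos (inv_pos.2 ha) hr), Real.rpow_def_of_pos (inv_pos.2 hb),
      Real.rpow_def_of_pos (inv_pos.2 ha), ← Real.exp_add, ← Real.exp_add, Real.exp_le_exp,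
      Real.log_mul (inv_pos.2 ha).ne' hr.ne', Real.log_inv, Real.log_inv]
    rw [Real.log_div hb.ne' ha.ne'] at h
    linarith
  calc _ ≤ (a⁻¹ + a⁻¹ * (2 - b / a)) * (a + b) :=
        mul_le_mul_of_nonneg_right (by linarith) (by linarith)
    _ = 4 - (1 - b / a) ^ 2 := by
        field_simp
        ring
    _ ≤ 4 := by linarith [sq_nonneg (1 - b / a)]

/-- Induction on the dimension. On each half of the cube, ψ interpolates between the functions
obtained for the two halves, with a weight θ for switching plus θ²/8. Hölder controls the
exponential sum. Switching the first coordinate lowers the bound by θa₀, and θ²/8 - θa₀ + 2a₀² = (θ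
- 4a₀)²/8 ≥ 0 absorbs this loss. -/
lemma exists_transport_function (m : ℕ) : ∀ φ : (Fin m → Bool) → ℝ,
    ∃ ψ : (Fin m → Bool) → ℝ,
      (∑ x, Real.exp (ψ x)) * (∑ x, Real.exp (-φ x)) ≤ 4 ^ m ∧
      ∀ (x : Fin m → Bool) (K : ℝ) (a : Fin m → ℝ),
        (∀ y, K - ∑ i, (if y i = x i then 0 else a i) ≤ φ y) → K - 2 * ∑ i, a i ^ 2 ≤ ψ x := by
  induction m with
  | zero =>
    intro φ
    refine ⟨φ, ?_, fun x K a h => ?_⟩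
    · simp [← Real.exp_add]
    · simpa using h x
  | succ m ih =>
    intro φ
    choose ψ hψ1 hψ2 using fun b : Bool => ih fun x => φ (Fin.cons b x)
    have hsum : ∀ f : (Fin (m + 1) → Bool) → ℝ, ∑ x, f x =
        ∑ x, f (Fin.cons true x) + ∑ x, f (Fin.cons false x) := by
      intro f
      rw [← (Fin.consEquiv fun _ => Bool).sum_comp, Fintype.sum_prod_type]
      simp [Fin.consEquiv]
    set A : Bool → ℝ := fun b => ∑ x, Real.exp (-φ (Fin.cons b x)) with hA
    have hApos : ∀ b, 0 < A b := fun b => Finset.sum_pos (fun x _ => Real.exp_pos _) ⟨default, by simp⟩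
    set B : Bool → ℝ := fun b => ∑ x, Real.exp (ψ b x) with hB
    have hBpos : ∀ b, 0 < B b := fun b => Finset.sum_pos (fun x _ => Real.exp_pos _) ⟨default, by simp⟩
    -- The half with the larger exponential sum does not interpolate; only the other half uses a
    -- nontrivial θ.
    have hθ : ∃ θ : Bool → ℝ, (∀ b, 0 ≤ θ b ∧ θ b ≤ 1) ∧
        (Real.exp (θ true ^ 2 / 8) * ((A true)⁻¹ ^ (1 - θ true) * (A false)⁻¹ ^ θ true) +
         Real.exp (θ false ^ 2 / 8) * ((A false)⁻¹ ^ (1 - θ false) * (A true)⁻¹ ^ θ false)) *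
          (A true + A false) ≤ 4 := by
      rcases le_total (A false) (A true) with hle | hle
      · obtain ⟨θ, h0, h1, h⟩ := exists_exponents (hApos false) hle
        refine ⟨fun b => bif b then 0 else θ, fun b => by cases b <;> simp [h0, h1], ?_⟩
        simpa using h
      · obtain ⟨θ, h0, h1, h⟩ := exists_exponents (hApos true) hle
        refine ⟨fun b => bif b then θ else 0, fun b => by cases b <;> simp [h0, h1], ?_⟩
        rw [add_comm (A true)]
        simpa [add_comm] using h
    obtain ⟨θ, hθ01, hθ⟩ := hθ
    let ψ' : (Fin (m + 1) → Bool) → ℝ := fun x =>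
      (1 - θ (x 0)) * ψ (x 0) (Fin.tail x) + θ (x 0) * ψ (!x 0) (Fin.tail x) + θ (x 0) ^ 2 / 8
    refine ⟨ψ', ?_, ?_⟩
    · have hle : ∀ b, ∑ x, Real.exp (ψ' (Fin.cons b x)) ≤
          4 ^ m * (Real.exp (θ b ^ 2 / 8) * ((A b)⁻¹ ^ (1 - θ b) * (A !b)⁻¹ ^ θ b)) := by
        intro b
        have hBA : ∀ b, B b ≤ 4 ^ m * (A b)⁻¹ := fun b => by
          rw [← div_eq_mul_inv, le_div_iff₀ (hApos b)]
          exact hψ1 b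
        have h0 := (hθ01 b).1
        have h1 := (hθ01 b).2
        calc ∑ x, Real.exp (ψ' (Fin.cons b x))
            = Real.exp (θ b ^ 2 / 8) *
                ∑ x, Real.exp ((1 - θ b) * ψ b x + θ b * ψ (!b) x) := by
              rw [Finset.mul_sum]
              refine Finset.sum_congr rfl fun x _ => ?_
              rw [← Real.exp_add]
              simp only [ψ', Fin.cons_zero, Fin.tail_cons]
              congr 1
              ring
          _ ≤ Real.exp (θ b ^ 2 / 8) * (B b ^ (1 - θ b) * B (!b) ^ θ b) :=
              mul_le_mul_of_nonneg_left (sum_exp_convex_comb_le _ _ h0 h1) (Real.exp_pos _).le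
          _ ≤ Real.exp (θ b ^ 2 / 8) *
                ((4 ^ m * (A b)⁻¹) ^ (1 - θ b) * (4 ^ m * (A !b)⁻¹) ^ θ b) := by
              refine mul_le_mul_of_nonneg_left (mul_le_mul
                (Real.rpow_le_rpow (hBpos _).le (hBA _) (sub_nonneg.2 h1))
                (Real.rpow_le_rpow (hBpos _).le (hBA _) h0) (Real.rpow_nonneg (hBpos _).le _)
                (Real.rpow_nonneg ?_ _)) (Real.exp_pos _).le
              exact (hBpos _).le.trans (hBA _)
          _ = _ := by
              have h4 : (0 : ℝ) < 4 ^ m := by positivity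
              rw [Real.mul_rpow h4.le (inv_nonneg.2 (hApos _).le),
                Real.mul_rpow h4.le (inv_nonneg.2 (hApos _).le)]
              have : ((4 : ℝ) ^ m) ^ (1 - θ b) * ((4 : ℝ) ^ m) ^ θ b = 4 ^ m := by
                rw [← Real.rpow_add h4]
                simp
              linear_combination (Real.exp (θ b ^ 2 / 8) * ((A b)⁻¹ ^ (1 - θ b) *
                (A !b)⁻¹ ^ θ b)) * this
      rw [hsum, hsum]
      calc _ ≤ (4 ^ m * (Real.exp (θ true ^ 2 / 8) *
              ((A true)⁻¹ ^ (1 - θ true) * (A false)⁻¹ ^ θ true)) +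
            4 ^ m * (Real.exp (θ false ^ 2 / 8) *
              ((A false)⁻¹ ^ (1 - θ false) * (A true)⁻¹ ^ θ false))) * (A true + A false) :=
            mul_le_mul_of_nonneg_right (add_le_add (hle true) (hle false))
              (add_pos (hApos _) (hApos _)).le
        _ ≤ 4 ^ m * 4 := by
            rw [← mul_add, mul_assoc]
            exact mul_le_mul_of_nonneg_left hθ (by positivity)
        _ = 4 ^ (m + 1) := by ring
    · intro x K a h
      have h0 := (hθ01 (x 0)).1
      have h1 := (hθ01 (x 0)).2
      have hx : ∀ b, (K - (if b = x 0 then 0 else a 0)) - 2 * ∑ i : Fin m, a i.succ ^ 2 ≤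
          ψ b (Fin.tail x) := by
        intro b
        refine hψ2 b (Fin.tail x) _ (fun i => a i.succ) fun y => ?_
        have := h (Fin.cons b y)
        rw [Fin.sum_univ_succ] at this
        simp only [Fin.cons_zero, Fin.cons_succ] at this
        rw [← sub_sub] at this
        exact this
      have e1 := hx (x 0)
      have e2 := hx (!x 0)
      rw [if_pos rfl] at e1
      rw [if_neg (by simp)] at e2
      rw [Fin.sum_univ_succ]
      have e3 := mul_le_mul_of_nonneg_left e1 (sub_nonneg.2 h1)
      have e4 := mul_le_mul_of_nonneg_left e2 h0
      simp only [ψ']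
      nlinarith [sq_nonneg (θ (x 0) - 4 * a 0)]

/-- The exponential moments of a function on the hypercube that increases by at most
`∑ aᵢ` over the changed coordinates, for some `a` with `∑ aᵢ ^ 2 ≤ v` that may depend on the
starting point. -/
lemma sum_exp_mul_sum_exp_neg_le {m : ℕ} (g : (Fin m → Bool) → ℝ) {v : ℝ}
    (hg : ∀ x, ∃ a : Fin m → ℝ, ∑ i, a i ^ 2 ≤ v ∧
      ∀ y, g y ≤ g x + ∑ i, (if y i = x i then 0 else a i)) {c : ℝ} (hc : 0 ≤ c) :
    (∑ x, Real.exp (c * g x)) * (∑ x, Real.exp (-(c * g x))) ≤ 4 ^ m * Real.exp (2 * c ^ 2 * v) := by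
  obtain ⟨ψ, h1, h2⟩ := exists_transport_function m fun x => -(c * g x)
  have h3 : ∀ x, Real.exp (-(c * g x)) ≤ Real.exp (2 * c ^ 2 * v) * Real.exp (ψ x) := by
    intro x
    rw [← Real.exp_add, Real.exp_le_exp]
    obtain ⟨a, ha, hax⟩ := hg x
    have h4 := h2 x (-(c * g x)) (fun i => c * a i) fun y => by
      have h5 := mul_le_mul_of_nonneg_left (hax y) hc
      rw [mul_add, Finset.mul_sum] at h5
      simp only [mul_ite, mul_zero] at h5
      linarith
    simp only [mul_pow] at h4
    rw [← Finset.mul_sum] at h4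
    nlinarith [sq_nonneg c]
  calc _ ≤ (∑ x, Real.exp (c * g x)) * ∑ x, Real.exp (2 * c ^ 2 * v) * Real.exp (ψ x) :=
        mul_le_mul_of_nonneg_left (Finset.sum_le_sum fun x _ => h3 x)
          (Finset.sum_nonneg fun x _ => (Real.exp_pos _).le)
    _ = (∑ x, Real.exp (ψ x)) * (∑ x, Real.exp (- -(c * g x))) * Real.exp (2 * c ^ 2 * v) := by
        rw [← Finset.mul_sum]
        simp only [neg_neg]
        ring
    _ ≤ _ := mul_le_mul_of_nonneg_right h1 (Real.exp_pos _).le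

/-- Few points of the hypercube have a value that differs much from that of the opposite point. -/
lemma card_antipodal_le {m : ℕ} (g : (Fin m → Bool) → ℝ) {v t : ℝ} (hv : 0 < v) (ht : 0 ≤ t)
    (hg : ∀ x, ∃ a : Fin m → ℝ, ∑ i, a i ^ 2 ≤ v ∧
      ∀ y, g y ≤ g x + ∑ i, (if y i = x i then 0 else a i)) :
    ((Finset.univ.filter fun x : Fin m → Bool => t < |g x - g fun i => !x i|).card : ℝ) ≤
      2 ^ m * (2 * Real.exp (-(t ^ 2 / (16 * v)))) := by
  classical
  let σ : Equiv.Perm (Fin m → Bool) := Equiv.piCongrRight fun _ => Equiv.boolNot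
  have hσ : ∀ x : Fin m → Bool, σ x = fun i => !x i := fun x => rfl
  have hσσ : ∀ x : Fin m → Bool, σ (σ x) = x := fun x => by simp [hσ]
  -- Minimizes the exponent 4c²v - ct, with value -t²/(16v).
  set c : ℝ := t / (8 * v) with hc
  have hc0 : 0 ≤ c := by positivity
  have hE : ∑ x, Real.exp (c * (g x - g (σ x))) ≤ 2 ^ m * Real.exp (4 * c ^ 2 * v) := by
    -- Cauchy–Schwarz separates `x` from its opposite; the antipodal bijection removes `σ` from the
    -- second factor.
    have h1 := Finset.sum_mul_sq_le_sq_mul_sq Finset.univ (fun x => Real.exp (c * g x))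
      (fun x => Real.exp (-(c * g (σ x))))
    have h2 := sum_exp_mul_sum_exp_neg_le g hg (c := 2 * c) (by positivity)
    have e1 : ∀ x, Real.exp (c * g x) ^ 2 = Real.exp (2 * c * g x) := fun x => by
      rw [← Real.exp_nat_mul]
      congr 1
      push_cast
      ring
    have e2 : ∑ x, Real.exp (-(c * g (σ x))) ^ 2 = ∑ x, Real.exp (-(2 * c * g x)) := by
      rw [← Equiv.sum_comp σ fun x => Real.exp (-(2 * c * g x))]
      refine Finset.sum_congr rfl fun x _ => ?_
      rw [← Real.exp_nat_mul]
      congr 1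
      push_cast
      ring
    simp only [e1, e2, ← Real.exp_add] at h1
    have h3 := h1.trans h2
    have e3 : (4 : ℝ) ^ m * Real.exp (2 * (2 * c) ^ 2 * v) =
        (2 ^ m * Real.exp (4 * c ^ 2 * v)) ^ 2 := by
      rw [mul_pow (2 ^ m : ℝ), ← Real.exp_nat_mul, ← pow_mul, mul_comm m 2, pow_mul,
        show (2 : ℝ) ^ 2 = 4 by norm_num]
      congr 2
      push_cast
      ring
    rw [e3] at h3
    have h4 := (pow_le_pow_iff_left₀ (Finset.sum_nonneg fun x _ => (Real.exp_pos _).le)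
      (by positivity) two_ne_zero).1 h3
    refine le_trans (le_of_eq ?_) h4
    refine Finset.sum_congr rfl fun x _ => ?_
    congr 1
    ring
  have hone : ((Finset.univ.filter fun x => t < g x - g (σ x)).card : ℝ) ≤
      2 ^ m * Real.exp (-(t ^ 2 / (16 * v))) := by
    have h1 : ((Finset.univ.filter fun x => t < g x - g (σ x)).card : ℝ) * Real.exp (c * t) ≤
        ∑ x, Real.exp (c * (g x - g (σ x))) := by
      rw [← nsmul_eq_mul]
      refine (Finset.card_nsmul_le_sum _ (fun x => Real.exp (c * (g x - g (σ x)))) _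
        fun x hx => ?_).trans (Finset.sum_le_sum_of_subset_of_nonneg (Finset.filter_subset _ _)
          fun x _ _ => (Real.exp_pos _).le)
      rw [Finset.mem_filter] at hx
      exact Real.exp_le_exp.2 (mul_le_mul_of_nonneg_left hx.2.le hc0)
    rw [← le_div_iff₀ (Real.exp_pos _)] at h1
    refine h1.trans ((div_le_div_of_nonneg_right hE (Real.exp_pos _).le).trans (le_of_eq ?_))
    rw [mul_div_assoc, ← Real.exp_sub]
    congr 2
    rw [hc]
    field_simp
    ring
  have htwo : (Finset.univ.filter fun x => t < g (σ x) - g x).card =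
      (Finset.univ.filter fun x => t < g x - g (σ x)).card := by
    refine Finset.card_bij (fun x _ => σ x) ?_ (fun _ _ _ _ h => σ.injective h) ?_
    · intro x hx
      simpa [hσσ] using hx
    · intro x hx
      exact ⟨σ x, by simpa [hσσ] using hx, hσσ x⟩
  have hsub : (Finset.univ.filter fun x : Fin m → Bool => t < |g x - g fun i => !x i|) ⊆
      (Finset.univ.filter fun x => t < g x - g (σ x)) ∪
        Finset.univ.filter fun x => t < g (σ x) - g x := by
    intro x hx
    simp only [Finset.mem_filter, Finset.mem_univ, true_and, Finset.mem_union, hσ] at hx ⊢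
    rcases lt_abs.1 hx with h | h
    · exact Or.inl h
    · exact Or.inr (by linarith)
  have h1 := (Finset.card_le_card hsub).trans (Finset.card_union_le _ _)
  rw [htwo] at h1
  have h2 : ((Finset.univ.filter fun x : Fin m → Bool => t < |g x - g fun i => !x i|).card : ℝ) ≤
      (Finset.univ.filter fun x => t < g x - g (σ x)).card +
        (Finset.univ.filter fun x => t < g x - g (σ x)).card := by exact_mod_cast h1
  linarith

/-! ### Symmetrization -/

/-- All preimages of `B` have measure `μ B`, so `μ B` is the mean over `x` of the proportion of maps
that send `x` into `B`. -/
lemma measure_le_of_symmetrization {Ω ι : Type*} [MeasurableSpace Ω] {μ : Measure Ω}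
    [IsProbabilityMeasure μ] [Fintype ι] [Nonempty ι] {T : ι → Ω → Ω}
    (hT : ∀ i, MeasurePreserving (T i) μ μ) {B : Set Ω} (hB : MeasurableSet B) {c : ℝ}
    (hc : ∀ᵐ x ∂μ, ({i | T i x ∈ B}.ncard : ℝ) ≤ Fintype.card ι * c) : μ B ≤ ENNReal.ofReal c := by
  classical
  have h1 : ∑ _i : ι, μ B ≤ ENNReal.ofReal (Fintype.card ι * c) := by
    calc ∑ _i : ι, μ B = ∑ i, ∫⁻ x, (T i ⁻¹' B).indicator 1 x ∂μ := by
          refine Finset.sum_congr rfl fun i _ => ?_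
          rw [lintegral_indicator_one ((hT i).measurable hB), (hT i).measure_preimage
            hB.nullMeasurableSet]
      _ = ∫⁻ x, ∑ i, (T i ⁻¹' B).indicator 1 x ∂μ := by
          rw [lintegral_finsetSum]
          exact fun i _ => measurable_one.indicator ((hT i).measurable hB)
      _ ≤ ∫⁻ _, ENNReal.ofReal (Fintype.card ι * c) ∂μ := by
          refine lintegral_mono_ae (hc.mono fun x hx => ?_)
          have : ∑ i, (T i ⁻¹' B).indicator (1 : Ω → ENNReal) x =
              ({i | T i x ∈ B}.ncard : ENNReal) := by
            simp only [Set.indicator_apply, Set.mem_preimage, Pi.one_apply, Finset.sum_boole,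
              Set.ncard_eq_toFinset_card', Set.toFinset_ofPred]
          rw [this, ← ENNReal.ofReal_natCast]
          exact ENNReal.ofReal_le_ofReal hx
      _ = ENNReal.ofReal (Fintype.card ι * c) := by simp
  rw [Finset.sum_const, Finset.card_univ, nsmul_eq_mul, ENNReal.ofReal_mul (Nat.cast_nonneg _),
    ENNReal.ofReal_natCast] at h1
  exact (ENNReal.mul_le_mul_iff_right (by simp) (by simp)).1 h1

/-- Exchange of some coordinates of a pair of points of a product. -/
def exchange {ι γ : Type*} (S : ι → Bool) (x : (ι → γ) × (ι → γ)) : (ι → γ) × (ι → γ) :=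
  (fun i => bif S i then x.2 i else x.1 i, fun i => bif S i then x.1 i else x.2 i)

/-- Seen as a product of pairs, the map swaps the factors of some pairs. -/
lemma measurePreserving_exchange {ι γ : Type*} [Fintype ι] [MeasurableSpace γ]
    (μ : ι → Measure γ) [∀ i, IsProbabilityMeasure (μ i)] (S : ι → Bool) :
    MeasurePreserving (exchange S) ((Measure.pi μ).prod (Measure.pi μ))
      ((Measure.pi μ).prod (Measure.pi μ)) := by
  have h1 := measurePreserving_arrowProdEquivProdArrow γ γ ι μ μ
  have h2 : MeasurePreserving (fun (a : ι → γ × γ) i => (if S i then Prod.swap else id) (a i))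
      (Measure.pi fun i => (μ i).prod (μ i)) (Measure.pi fun i => (μ i).prod (μ i)) := by
    refine measurePreserving_pi _ _ fun i => ?_
    cases S i
    · exact MeasurePreserving.id _
    · exact Measure.measurePreserving_swap
  have h3 := (h1.comp h2).comp h1.symm
  convert h3 using 1
  funext x
  ext i
  · simp only [exchange, Function.comp, MeasurableEquiv.arrowProdEquivProdArrow]
    cases h : S i <;> simp [Equiv.arrowProdEquivProdArrow, h]
  · simp only [exchange, Function.comp, MeasurableEquiv.arrowProdEquivProdArrow]
    cases h : S i <;> simp [Equiv.arrowProdEquivProdArrow, h]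

/-! ### Measurability of distances and comparison of lengths -/

namespace Graph

variable {α β : Type*} {G : Graph α β}

lemma measurable_wdist [Countable β] {Ω : Type*} [MeasurableSpace Ω] {W : Ω → β → ℝ}
    (hW : ∀ e, Measurable fun x => W x e) (u v : α) : Measurable fun x => G.wdist (W x) u v := by
  -- Lengths depend only on edge lists, so the infimum is over a countable type.
  let f : G.Walk u v → {l : List β // ∃ p : G.Walk u v, p.edges = l} := fun p => ⟨p.edges, p, rfl⟩
  have hf : Function.Surjective f := by
    rintro ⟨_, p, rfl⟩
    exact ⟨p, rfl⟩
  have h : (fun x => G.wdist (W x) u v) =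
      fun x => ⨅ l : {l : List β // ∃ p : G.Walk u v, p.edges = l}, (l.1.map (W x)).sum := by
    funext x
    exact hf.iInf_comp fun l => (l.1.map (W x)).sum
  rw [h]
  refine Measurable.iInf fun l => ?_
  induction l.1 with
  | nil => simp
  | cons e l ih =>
    simp only [List.map_cons, List.sum_cons]
    exact (hW e).add ih

lemma Walk.length_le_mul {w w' : β → ℝ} {c : ℝ} (h : ∀ e, w e ≤ c * w' e) {u v : α}
    (p : G.Walk u v) : p.length w ≤ c * p.length w' := by
  induction p with
  | nil hu => simp
  | cons e he p ih =>
    rw [length_cons, length_cons, mul_add]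
    exact add_le_add (h e) ih

lemma Walk.length_eq_sum [DecidableEq β] (w : β → ℝ) {u v : α} (p : G.Walk u v)
    (hp : p.vertices.Nodup) : p.length w = ∑ e ∈ p.edges.toFinset, w e :=
  (List.sum_toFinset w (p.edges_nodup hp)).symm

end Graph

/-! ### The demand model -/

namespace DemandModel

variable {α β : Type*} {m : ℕ} (M : DemandModel α β m)

/-- The demands lie in their ranges. -/
def InRange (y : Fin m → ℝ) : Prop := ∀ i, y i ∈ Set.Icc (M.lo i) (M.ρ * M.lo i)

lemma ae_inRange : ∀ᵐ y ∂M.demandLaw, M.InRange y :=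
  eventually_all.2 fun i => Measure.tendsto_eval_ae_ae.eventually (M.law_mem i)

lemma ae_inRange_prod : ∀ᵐ x ∂M.demandLaw.prod M.demandLaw, M.InRange x.1 ∧ M.InRange x.2 := by
  have : IsProbabilityMeasure M.demandLaw := by unfold demandLaw; infer_instance
  exact (Measure.quasiMeasurePreserving_fst.ae M.ae_inRange).and
    (Measure.quasiMeasurePreserving_snd.ae M.ae_inRange)

lemma one_le_rpow : 1 ≤ M.ρ ^ M.expo := Real.one_le_rpow M.one_le_ρ M.expo_nonneg

variable {M}

lemma InRange.weight_le {y : Fin m → ℝ} (hy : M.InRange y) (e : β) :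
    M.weight y e ≤ M.ρ ^ M.expo * M.basicWeight e := by
  have hρ : 0 ≤ M.ρ := zero_le_one.trans M.one_le_ρ
  have h0 : 0 ≤ ∑ i, M.dep i e * M.lo i :=
    Finset.sum_nonneg fun i _ => mul_nonneg (M.dep_nonneg i e) (M.lo_nonneg i)
  have h0' : 0 ≤ ∑ i, M.dep i e * y i :=
    Finset.sum_nonneg fun i _ => mul_nonneg (M.dep_nonneg i e) ((M.lo_nonneg i).trans (hy i).1)
  unfold basicWeight weight
  rw [← mul_assoc, ← Real.mul_rpow hρ h0]
  refine mul_le_mul_of_nonneg_right (Real.rpow_le_rpow h0' ?_ M.expo_nonneg) (M.w_nonneg e)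
  rw [Finset.mul_sum]
  refine Finset.sum_le_sum fun i _ => ?_
  rw [mul_left_comm]
  exact mul_le_mul_of_nonneg_left (hy i).2 (M.dep_nonneg i e)

lemma InRange.le_weight {y : Fin m → ℝ} (hy : M.InRange y) (e : β) :
    M.basicWeight e ≤ M.weight y e := by
  have h0 : 0 ≤ ∑ i, M.dep i e * M.lo i :=
    Finset.sum_nonneg fun i _ => mul_nonneg (M.dep_nonneg i e) (M.lo_nonneg i)
  refine mul_le_mul_of_nonneg_right (Real.rpow_le_rpow h0 ?_ M.expo_nonneg) (M.w_nonneg e)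
  exact Finset.sum_le_sum fun i _ => mul_le_mul_of_nonneg_left (hy i).1 (M.dep_nonneg i e)

lemma basicWeight_nonneg (e : β) : 0 ≤ M.basicWeight e :=
  mul_nonneg (Real.rpow_nonneg (Finset.sum_nonneg fun i _ =>
    mul_nonneg (M.dep_nonneg i e) (M.lo_nonneg i)) _) (M.w_nonneg e)

lemma InRange.weight_nonneg {y : Fin m → ℝ} (hy : M.InRange y) (e : β) : 0 ≤ M.weight y e :=
  (basicWeight_nonneg e).trans (hy.le_weight e)

lemma weight_congr {y y' : Fin m → ℝ} {e : β} (h : ∀ i, 0 < M.dep i e → y i = y' i) :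
    M.weight y e = M.weight y' e := by
  unfold weight
  congr 2
  refine Finset.sum_congr rfl fun i _ => ?_
  rcases (M.dep_nonneg i e).eq_or_lt with h0 | h0
  · simp [← h0]
  · rw [h i h0]

lemma measurable_weight (e : β) : Measurable fun y => M.weight y e := by
  unfold weight
  fun_prop

variable {s t : α}

lemma InRange.basic_length_le {y : Fin m → ℝ} (hy : M.InRange y) {u v : α} (p : M.G.Walk u v) :
    p.length M.basicWeight ≤ p.length (M.weight y) := by
  simpa using p.length_le_mul (c := 1) (fun e => by simpa using hy.le_weight e)

lemma InRange.basicDist_le {y : Fin m → ℝ} (hy : M.InRange y) (hst : M.G.Reachable s t) :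
    M.basicDist s t ≤ M.G.wdist (M.weight y) s t :=
  Graph.le_wdist hst fun p =>
    (Graph.wdist_le_length basicWeight_nonneg p).trans (hy.basic_length_le p)

lemma InRange.wdist_le [Finite β] {y : Fin m → ℝ} (hy : M.InRange y) (hst : M.G.Reachable s t) :
    M.G.wdist (M.weight y) s t ≤ M.ρ ^ M.expo * M.basicDist s t := by
  obtain ⟨p, hp⟩ := hst.elim fun p => p.exists_isShortestPath (basicWeight_nonneg (M := M))
  have := hp.length_eq basicWeight_nonneg
  refine (Graph.wdist_le_length hy.weight_nonneg p).trans ((p.length_le_mul hy.weight_le).trans ?_)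
  rw [this, basicDist]

/-- The shortest paths from `s` to `t` stay inside the search graph. -/
lemma InRange.exists_shortest [Finite β] {y : Fin m → ℝ} (hy : M.InRange y)
    (hst : M.G.Reachable s t) :
    ∃ p : M.G.Walk s t, p.IsShortestPath (M.weight y) ∧
      p.length M.basicWeight ≤ M.ρ ^ M.expo * M.basicDist s t ∧
      ∀ x ∈ p.vertices, x ∈ M.G.wball M.basicWeight s (M.ρ ^ M.expo * M.basicDist s t) := by
  obtain ⟨p, hp⟩ := hst.elim fun p => p.exists_isShortestPath hy.weight_nonneg
  have h1 : p.length M.basicWeight ≤ M.ρ ^ M.expo * M.basicDist s t := by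
    refine (hy.basic_length_le p).trans ?_
    rw [hp.length_eq hy.weight_nonneg]
    exact hy.wdist_le hst
  refine ⟨p, hp, h1, fun x hx => ?_⟩
  obtain ⟨h2, -, h3, -⟩ := p.wdist_le_of_mem (basicWeight_nonneg (M := M)) hx
  exact ⟨h2, h3.trans h1⟩

lemma InRange.wdist_searchGraph [Finite β] {y : Fin m → ℝ} (hy : M.InRange y)
    (hst : M.G.Reachable s t) :
    (M.searchGraph s t).wdist (M.weight y) s t = M.G.wdist (M.weight y) s t := by
  obtain ⟨p, hp, -, hpv⟩ := hy.exists_shortest hst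
  obtain ⟨q, hq⟩ := p.exists_induce hpv
  apply le_antisymm
  · rw [← hp.length_eq hy.weight_nonneg]
    refine (Graph.wdist_le_length (G := M.searchGraph s t) hy.weight_nonneg q).trans (le_of_eq ?_)
    exact congrArg (fun l => (l.map (M.weight y)).sum) hq
  · refine Graph.le_wdist (G := M.searchGraph s t) ⟨q⟩ fun p => ?_
    obtain ⟨q', hq'⟩ := p.exists_of_induce (Graph.wball_subset _ _)
    refine (Graph.wdist_le_length hy.weight_nonneg q').trans (le_of_eq ?_)
    exact congrArg (fun l => (l.map (M.weight y)).sum) hq'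

lemma threshold_nonneg {ε : ℝ} {ℓ : ℕ} (hL : 0 ≤ M.basicDist s t) (hn : 3 ≤ M.n) :
    0 ≤ M.threshold s t ε ℓ := by
  have : (1 : ℝ) ≤ 2 * M.n := by
    have : (3 : ℝ) ≤ M.n := by exact_mod_cast hn
    linarith
  have := Real.log_nonneg this
  have := Real.rpow_nonneg (zero_le_one.trans M.one_le_ρ) (3 * M.expo)
  unfold threshold
  positivity

lemma rpow_three_mul : M.ρ ^ (3 * M.expo) = (M.ρ ^ M.expo) ^ 3 := by
  rw [mul_comm, Real.rpow_mul (zero_le_one.trans M.one_le_ρ)]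
  exact_mod_cast Real.rpow_natCast _ 3

/-! ### Certificates and failure probability -/

section Fintype

variable [Fintype β] {ε : ℝ} {ℓ : ℕ}

/-- Changing unprobed demands increases the distance by a bounded amount per demand. -/
lemma InRange.exists_certificate {y : Fin m → ℝ} (hy : M.InRange y) (hst : M.G.Reachable s t)
    (hτ : 0 ≤ M.threshold s t ε ℓ) (hℓ : ∀ e ∈ E(M.G), {i | e ∈ M.cluster i}.ncard ≤ ℓ) :
    ∃ a : Fin m → ℝ, (∀ i, 0 ≤ a i) ∧
      ∑ i, a i ^ 2 ≤ (M.ρ ^ M.expo) ^ 3 * M.threshold s t ε ℓ * ℓ * M.basicDist s t ∧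
      ∀ y', M.InRange y' → (∀ i ∈ M.probed s t ε ℓ, y' i = y i) →
        M.G.wdist (M.weight y') s t ≤
          M.G.wdist (M.weight y) s t + ∑ i, (if y' i = y i then 0 else a i) := by
  classical
  obtain ⟨p, hp, hlen, hpv⟩ := hy.exists_shortest hst
  set P : ℝ := M.ρ ^ M.expo with hP
  have hP1 : 1 ≤ P := M.one_le_rpow
  have hb := basicWeight_nonneg (M := M)
  let A : Finset β := p.edges.toFinset
  let b : Fin m → ℝ := fun i => ∑ e ∈ A, if e ∈ M.cluster i then P * M.basicWeight e else 0
  have hterm : ∀ i e, 0 ≤ if e ∈ M.cluster i then P * M.basicWeight e else 0 := fun i e => by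
    split_ifs
    · exact mul_nonneg (by linarith) (hb e)
    · exact le_rfl
  have hb0 : ∀ i, 0 ≤ b i := fun i => Finset.sum_nonneg fun e _ => hterm i e
  -- Probed demands are never changed, so they cost nothing; the remaining clusters have size at
  -- most the threshold inside the search graph, which contains `p`.
  let a : Fin m → ℝ := fun i => if i ∈ M.probed s t ε ℓ then 0 else b i
  have ha0 : ∀ i, 0 ≤ a i := fun i => by
    simp only [a]
    split_ifs
    exacts [le_rfl, hb0 i]
  have hAE : ∀ e ∈ A, e ∈ E(M.G) ∧ e ∈ E(M.searchGraph s t) := by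
    intro e he
    have he' := List.mem_toFinset.1 he
    have heG := p.mem_edgeSet_of_mem_edges he'
    obtain ⟨x, z, hxz⟩ := M.G.exists_isLink_of_mem_edgeSet heG
    obtain ⟨h1, h2⟩ := p.mem_vertices_of_isLink he' hxz
    exact ⟨heG, x, z, hxz, hpv x h1, hpv z h2⟩
  refine ⟨a, ha0, ?_, fun y' hy' heq => ?_⟩
  · have h1 : ∀ i, a i ≤ P * M.threshold s t ε ℓ := by
      intro i
      simp only [a]
      split_ifs with hi
      · exact mul_nonneg (by linarith) hτ
      · have hi' : M.clusterSize s t i ≤ M.threshold s t ε ℓ := by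
          simpa [probed] using hi
        refine le_trans ?_ (mul_le_mul_of_nonneg_left hi' (by linarith))
        simp only [b, clusterSize]
        rw [← Finset.sum_filter, ← Finset.mul_sum]
        refine mul_le_mul_of_nonneg_left (Finset.sum_le_sum_of_subset_of_nonneg ?_
          fun e _ _ => hb e) (by linarith)
        intro e he
        rw [Finset.mem_filter] at he
        rw [Finset.mem_filter]
        exact ⟨Finset.mem_univ _, (hAE e he.1).2, he.2⟩
    have h2 : ∑ i, a i ≤ P * ℓ * (P * M.basicDist s t) := by
      calc ∑ i, a i ≤ ∑ i, b i := Finset.sum_le_sum fun i _ => by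
            simp only [a]
            split_ifs
            exacts [hb0 i, le_rfl]
        _ = ∑ e ∈ A, ∑ i, if e ∈ M.cluster i then P * M.basicWeight e else 0 :=
            Finset.sum_comm
        _ ≤ ∑ e ∈ A, P * ℓ * M.basicWeight e := by
            refine Finset.sum_le_sum fun e he => ?_
            have := hℓ e (hAE e he).1
            rw [Set.ncard_eq_toFinset_card', Set.toFinset_ofPred] at this
            rw [← Finset.sum_filter, Finset.sum_const, nsmul_eq_mul]
            have h3 : ((Finset.univ.filter fun i => e ∈ M.cluster i).card : ℝ) ≤ ℓ := by
              exact_mod_cast this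
            have := mul_le_mul_of_nonneg_right h3
              (mul_nonneg (by linarith : 0 ≤ P) (hb e))
            linarith
        _ = P * ℓ * p.length M.basicWeight := by
            rw [← Finset.mul_sum, p.length_eq_sum _ hp.1]
        _ ≤ _ := mul_le_mul_of_nonneg_left hlen (by positivity)
    calc ∑ i, a i ^ 2 ≤ ∑ i, P * M.threshold s t ε ℓ * a i :=
          Finset.sum_le_sum fun i _ => by
            rw [sq]
            exact mul_le_mul_of_nonneg_right (h1 i) (ha0 i)
      _ = P * M.threshold s t ε ℓ * ∑ i, a i := by rw [Finset.mul_sum]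
      _ ≤ P * M.threshold s t ε ℓ * (P * ℓ * (P * M.basicDist s t)) :=
          mul_le_mul_of_nonneg_left h2 (mul_nonneg (by linarith) hτ)
      _ = _ := by ring
  · refine (Graph.wdist_le_length hy'.weight_nonneg p).trans ?_
    rw [← hp.length_eq hy.weight_nonneg, p.length_eq_sum _ hp.1, p.length_eq_sum _ hp.1]
    have h3 : ∀ e ∈ A, M.weight y' e ≤ M.weight y e + ∑ i, (if y' i = y i then 0 else
        if e ∈ M.cluster i then P * M.basicWeight e else 0) := by
      intro e he
      have hnn : ∀ i, 0 ≤ (if y' i = y i then 0 else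
          if e ∈ M.cluster i then P * M.basicWeight e else 0) := fun i => by
        split_ifs
        · exact le_rfl
        · exact mul_nonneg (by linarith) (hb e)
        · exact le_rfl
      -- One changed demand influencing `e` pays for the whole new weight, which is at most `P *
      -- M.basicWeight e`.
      by_cases hex : ∃ i, y' i ≠ y i ∧ e ∈ M.cluster i
      · obtain ⟨i, hi, hei⟩ := hex
        have h4 := Finset.single_le_sum (f := fun i => if y' i = y i then 0 else
          if e ∈ M.cluster i then P * M.basicWeight e else 0) (fun i _ => hnn i)
          (Finset.mem_univ i)
        simp only [if_neg hi, if_pos hei] at h4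
        have h5 := hy'.weight_le e
        have h6 := hy.weight_nonneg e
        linarith
      · push Not at hex
        rw [weight_congr (y := y') (y' := y) fun i hi => by
          by_contra hne
          exact hex i hne ⟨(hAE e he).1, hi⟩]
        exact le_add_of_nonneg_right (Finset.sum_nonneg fun i _ => hnn i)
    refine (Finset.sum_le_sum h3).trans ?_
    rw [Finset.sum_add_distrib, Finset.sum_comm]
    refine add_le_add le_rfl (Finset.sum_le_sum fun i _ => ?_)
    split_ifs with hi
    · simp
    · simp only [a]
      rw [if_neg fun hpr => hi (heq i hpr)]

/-- With high probability, the algorithm approximates the distance. -/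
lemma measure_failure_le (hn : 3 ≤ M.n) (hst : M.G.Reachable s t) (hε : 0 < ε) (hℓ1 : 1 ≤ ℓ)
    (hℓ : ∀ e ∈ E(M.G), {i | e ∈ M.cluster i}.ncard ≤ ℓ) :
    (M.demandLaw.prod M.demandLaw)
      {yz | ¬ |M.output s t ε ℓ yz.1 yz.2 - M.G.wdist (M.weight yz.1) s t| ≤
        ε * M.G.wdist (M.weight yz.1) s t} ≤ ENNReal.ofReal (1 / M.n) := by
  classical
  have hprob : IsProbabilityMeasure M.demandLaw := by unfold demandLaw; infer_instance
  have hn' : (3 : ℝ) ≤ M.n := by exact_mod_cast hn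
  have hL0 : 0 ≤ M.basicDist s t := Graph.wdist_nonneg basicWeight_nonneg s t
  let S : (Fin m → Bool) → Fin m → Bool := fun σ i =>
    if i ∈ M.probed s t ε ℓ then false else σ i
  let x : (Fin m → ℝ) × (Fin m → ℝ) → (Fin m → Bool) → Fin m → ℝ := fun yz σ =>
    (exchange (S σ) yz).1
  have hxr : ∀ yz, M.InRange yz.1 ∧ M.InRange yz.2 → ∀ σ, M.InRange (x yz σ) := by
    intro yz h σ i
    simp only [x, exchange]
    cases S σ i
    exacts [h.1 i, h.2 i]
  -- After the exchange, the true demands are those selected by `σ`, and the algorithm works with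
  -- those selected by the opposite point.
  have hsim : ∀ yz σ, M.simulated s t ε ℓ (exchange (S σ) yz).1 (exchange (S σ) yz).2 =
      x yz fun i => !σ i := by
    intro yz σ
    funext i
    by_cases hi : i ∈ M.probed s t ε ℓ
    · simp [simulated, x, exchange, S, hi]
    · cases h : σ i <;> simp [simulated, x, exchange, S, hi, h]
  have hmeas : ∀ G : Graph α β, Measurable fun y => G.wdist (M.weight y) s t := fun G =>
    Graph.measurable_wdist measurable_weight s t
  have hsimm : Measurable fun yz : (Fin m → ℝ) × (Fin m → ℝ) =>
      M.simulated s t ε ℓ yz.1 yz.2 := by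
    refine measurable_pi_iff.2 fun i => ?_
    unfold simulated
    split_ifs <;> fun_prop
  refine measure_le_of_symmetrization (T := fun σ => exchange (S σ))
    (fun σ => measurePreserving_exchange M.law (S σ)) ?_ ?_
  · have h1 : Measurable fun yz : (Fin m → ℝ) × (Fin m → ℝ) => M.output s t ε ℓ yz.1 yz.2 :=
      (hmeas _).comp hsimm
    have h2 : Measurable fun yz : (Fin m → ℝ) × (Fin m → ℝ) =>
      M.G.wdist (M.weight yz.1) s t := (hmeas _).comp measurable_fst
    exact (measurableSet_le (h1.sub h2).abs (h2.const_mul ε)).compl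
  · filter_upwards [M.ae_inRange_prod] with yz hyz
    let g : (Fin m → Bool) → ℝ := fun σ => M.G.wdist (M.weight (x yz σ)) s t
    have hg : ∀ σ, M.basicDist s t ≤ g σ := fun σ => (hxr yz hyz σ).basicDist_le hst
    have hbad : {σ | exchange (S σ) yz ∈ {yz : (Fin m → ℝ) × (Fin m → ℝ) |
        ¬ |M.output s t ε ℓ yz.1 yz.2 - M.G.wdist (M.weight yz.1) s t| ≤
        ε * M.G.wdist (M.weight yz.1) s t}} ⊆
        {σ | ε * M.basicDist s t < |g σ - g fun i => !σ i|} := by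
      intro σ hσ
      simp only [Set.mem_ofPred_eq, not_le, output, hsim,
        (hxr yz hyz fun i => !σ i).wdist_searchGraph hst] at hσ
      rw [abs_sub_comm] at hσ
      exact (mul_le_mul_of_nonneg_left (hg σ) hε.le).trans_lt hσ
    have hcard := Set.ncard_le_ncard hbad (Set.toFinite _)
    have hcard' : (({σ | exchange (S σ) yz ∈ {yz : (Fin m → ℝ) × (Fin m → ℝ) |
        ¬ |M.output s t ε ℓ yz.1 yz.2 - M.G.wdist (M.weight yz.1) s t| ≤
        ε * M.G.wdist (M.weight yz.1) s t}}.ncard : ℕ) : ℝ) ≤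
        ({σ | ε * M.basicDist s t < |g σ - g fun i => !σ i|}.ncard : ℕ) := by
      exact_mod_cast hcard
    refine hcard'.trans ?_
    -- For `L = 0` all distances vanish; concentration needs a positive variance proxy.
    rcases hL0.eq_or_lt with hL | hL
    · have hg0 : ∀ σ, g σ = 0 := fun σ => le_antisymm
        (((hxr yz hyz σ).wdist_le hst).trans (by rw [← hL]; simp)) (hL.le.trans (hg σ))
      have : {σ | ε * M.basicDist s t < |g σ - g fun i => !σ i|} = ∅ := by
        ext σ
        simp [hg0, ← hL]
      rw [this]
      simp
    · set lg := Real.log (2 * M.n) with hlg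
      have hlg0 : 0 < lg := Real.log_pos (by linarith)
      set v : ℝ := ε ^ 2 * M.basicDist s t ^ 2 / (16 * lg) with hv
      have hv0 : 0 < v := by positivity
      have hP1 := M.one_le_rpow
      have hℓ' : (1 : ℝ) ≤ ℓ := by exact_mod_cast hℓ1
      have hvle : (M.ρ ^ M.expo) ^ 3 * M.threshold s t ε ℓ * ℓ * M.basicDist s t = v := by
        rw [threshold, rpow_three_mul, ← hlg, hv]
        have : M.ρ ^ M.expo ≠ 0 := by positivity
        have : (ℓ : ℝ) ≠ 0 := by positivity
        field_simp
      have := card_antipodal_le g hv0 (mul_pos hε hL).le (by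
        intro σ
        obtain ⟨a, ha0, hav, ha⟩ := (hxr yz hyz σ).exists_certificate hst
          (threshold_nonneg (ε := ε) hL0 hn) hℓ
        rw [hvle] at hav
        refine ⟨a, hav, fun σ' => (ha _ (hxr yz hyz σ') ?_).trans
          (add_le_add le_rfl (Finset.sum_le_sum fun i _ => ?_))⟩
        · intro i hi
          simp [x, exchange, S, hi]
        · by_cases hi : σ' i = σ i
          · rw [if_pos hi, if_pos]
            simp [x, exchange, S, hi]
          · rw [if_neg hi]
            split_ifs
            exacts [ha0 i, le_rfl])
      rw [Set.ncard_eq_toFinset_card', Set.toFinset_ofPred]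
      refine this.trans (le_of_eq ?_)
      have e1 : (ε * M.basicDist s t) ^ 2 / (16 * v) = lg := by
        rw [hv]
        field_simp
      rw [e1, Real.exp_neg, Real.exp_log (by linarith)]
      simp
      field_simp

end Fintype

end DemandModel

/-! ### Counting the probed demands -/

lemma one_lt_log_three : 1 < Real.log 3 := by
  rw [Real.lt_log_iff_exp_lt (by norm_num)]
  exact Real.exp_one_lt_d9.trans (by norm_num)

/-- In logarithms: `J ≤ 6 + 6 * log X` and `log (h + 1) ≤ 2 * log h` give 12 log h (1 + log X), and
h²ℓ adds at most 2 log h (1 + log X), using 1 ≤ 2 log h. The bound `κ ≤ log X` turns the constant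
part into a multiple of `log X`. -/
lemma natCast_le_rpow_of_le {X κ : ℝ} (hκ : 0 < κ) (hX : κ ≤ Real.log X) (hX1 : 0 < X)
    {N h ℓ J : ℕ} (hh : 2 ≤ h) (hℓ : 1 ≤ ℓ) (hℓX : (ℓ : ℝ) ≤ X)
    (hJ : (J : ℝ) ≤ Real.log (32 * X ^ 4) / Real.log 2 + 1)
    (hN : N ≤ (h + 1) ^ J * (h * (h * ℓ))) :
    (N : ℝ) ≤ X ^ ((14 / κ + 14) * Real.log h) := by
  have hh' : (2 : ℝ) ≤ h := by exact_mod_cast hh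
  have hℓ' : (1 : ℝ) ≤ ℓ := by exact_mod_cast hℓ
  have hl2 : 0.6931 < Real.log 2 := lt_trans (by norm_num) Real.log_two_gt_d9
  have hlh : Real.log 2 ≤ Real.log h := Real.log_le_log (by norm_num) hh'
  have hN' : (N : ℝ) ≤ (h + 1) ^ J * (h * (h * ℓ)) := by exact_mod_cast hN
  refine hN'.trans ?_
  have hpos : (0 : ℝ) < (h + 1) ^ J * (h * (h * ℓ)) := by positivity
  rw [← Real.log_le_log_iff hpos (Real.rpow_pos_of_pos hX1 _), Real.log_rpow hX1,
    Real.log_mul (by positivity) (by positivity), Real.log_pow,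
    Real.log_mul (by positivity) (by positivity), Real.log_mul (by positivity) (by positivity)]
  have h1 : Real.log (h + 1) ≤ 2 * Real.log h := by
    have : Real.log ((h : ℝ) ^ 2) = 2 * Real.log h := by
      rw [Real.log_pow]
      norm_num
    rw [← this]
    exact Real.log_le_log (by positivity) (by nlinarith)
  have h2 : Real.log ℓ ≤ Real.log X := Real.log_le_log (by positivity) hℓX
  have h3 : (J : ℝ) ≤ 6 + 6 * Real.log X := by
    rw [Real.log_mul (by norm_num) (by positivity), Real.log_pow,
      show (32 : ℝ) = 2 ^ 5 by norm_num, Real.log_pow] at hJ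
    have : (((5 : ℕ) : ℝ) * Real.log 2 + ((4 : ℕ) : ℝ) * Real.log X) / Real.log 2 ≤
        5 + 6 * Real.log X := by
      rw [div_le_iff₀ (by linarith)]
      push_cast
      nlinarith
    linarith
  have h4 : (J : ℝ) * Real.log (h + 1) ≤ (6 + 6 * Real.log X) * (2 * Real.log h) :=
    mul_le_mul h3 h1 (Real.log_nonneg (by linarith)) (by linarith)
  have h5 : 14 * Real.log h ≤ 14 / κ * Real.log h * Real.log X := by
    have : 14 ≤ 14 / κ * Real.log X := by
      rw [div_mul_eq_mul_div, le_div_iff₀ hκ]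
      linarith
    nlinarith
  have h6 : Real.log X ≤ 2 * Real.log h * Real.log X := by nlinarith
  nlinarith

namespace DemandModel

variable {α β : Type*} {m : ℕ} {M : DemandModel α β m} {s t : α}

/-- The search graph then has radius zero, and an edge of a shortest path is no heavier than the
distance between its ends. -/
lemma basicWeight_eq_zero_of_basicDist_eq_zero (hL : M.basicDist s t = 0) {C : Set β}
    (hC : M.G.IsShortestPathEdgeSet M.basicWeight C) {e : β} (he : e ∈ E(M.searchGraph s t))
    (heC : e ∈ C) : M.basicWeight e = 0 := by
  have hb := basicWeight_nonneg (M := M)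
  obtain ⟨u, v, p, hp, rfl⟩ := hC
  obtain ⟨a, b, hab, ha, hb'⟩ := he
  rw [hL, mul_zero] at ha hb'
  have h1 := hp.weight_le_wdist heC hab hb
  have h2 := Graph.wdist_triangle hb ha.1.symm hb'.1
  rw [Graph.wdist_comm hb a s] at h2
  exact le_antisymm (by linarith [ha.2, hb'.2]) (hb e)

/-- The algorithm probes few demands. -/
lemma card_probed_le [Finite α] [Fintype β] {h ℓ : ℕ} {ε : ℝ} (hn : 3 ≤ M.n)
    (hst : M.G.Reachable s t) (hε : 0 < ε) (hε1 : ε ≤ 1) (hℓ1 : 1 ≤ ℓ)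
    (hh : M.G.HasContinuousHighwayDim M.basicWeight h)
    (hC : ∀ i, M.G.IsShortestPathEdgeSet M.basicWeight (M.cluster i))
    (hℓ : ∀ e ∈ E(M.G), {i | e ∈ M.cluster i}.ncard ≤ ℓ) :
    ((M.probed s t ε ℓ).card : ℝ) ≤ (Real.log M.n * M.ρ ^ M.expo * ℓ / ε ^ 2) ^
      ((14 / Real.log (Real.log 3) + 14) * Real.log h) := by
  classical
  have hn' : (3 : ℝ) ≤ M.n := by exact_mod_cast hn
  have hℓ' : (1 : ℝ) ≤ ℓ := by exact_mod_cast hℓ1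
  have hb := basicWeight_nonneg (M := M)
  have hL0 : 0 ≤ M.basicDist s t := Graph.wdist_nonneg hb s t
  set P : ℝ := M.ρ ^ M.expo with hP
  have hP1 : 1 ≤ P := M.one_le_rpow
  set g := Real.log M.n with hg
  have hg3 : Real.log 3 ≤ g := Real.log_le_log (by norm_num) hn'
  have hl3 := one_lt_log_three
  have hg1 : 1 ≤ g := by linarith
  have hε2 : ε ^ 2 ≤ 1 := pow_le_one₀ hε.le hε1
  set X : ℝ := g * P * ℓ / ε ^ 2 with hX
  have hXg : g * P * ℓ ≤ X := by
    rw [hX, le_div_iff₀ (by positivity)]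
    exact mul_le_of_le_one_right (by positivity) hε2
  have hgX : g ≤ X := by
    refine le_trans ?_ hXg
    rw [mul_assoc]
    exact le_mul_of_one_le_right (by linarith) (one_le_mul_of_one_le_of_one_le hP1 hℓ')
  have hℓX : (ℓ : ℝ) ≤ X := by
    refine le_trans ?_ hXg
    exact le_mul_of_one_le_left (by linarith) (one_le_mul_of_one_le_of_one_le hg1 hP1)
  have hX0 : 0 < X := by linarith
  have hne : (M.probed s t ε ℓ).Nonempty ∨ M.probed s t ε ℓ = ∅ :=
    (Finset.eq_empty_or_nonempty _).symm
  rcases hne with hne | hne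
  -- Without probes the bound holds for every `h`; in the other case the hub count yields `2 ≤ h`.
  swap
  · rw [hne, Finset.card_empty, Nat.cast_zero]
    exact Real.rpow_nonneg hX0.le _
  have hprobed : ∀ i ∈ M.probed s t ε ℓ, M.threshold s t ε ℓ < M.clusterSize s t i := by
    intro i hi
    simpa [probed] using hi
  have hL : 0 < M.basicDist s t := by
    refine hL0.lt_of_ne fun hL => ?_
    obtain ⟨i, hi⟩ := hne
    have h1 := hprobed i hi
    have h2 : M.clusterSize s t i = 0 := Finset.sum_eq_zero fun e he =>
      basicWeight_eq_zero_of_basicDist_eq_zero hL.symm (hC i) (Finset.mem_filter.1 he).2.1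
        (Finset.mem_filter.1 he).2.2
    have h3 := threshold_nonneg (M := M) (ε := ε) (ℓ := ℓ) hL0 hn
    linarith
  have h2X : 1 ≤ 32 * X ^ 4 := by
    have : 1 ≤ X ^ 4 := one_le_pow₀ (by linarith)
    linarith
  have hl2 : 0 < Real.log 2 := Real.log_pos (by norm_num)
  -- The fourth power of `X` covers the factor `P ^ 4` in `R / τ`: one `P` from the radius and three
  -- from the threshold.
  obtain ⟨J, hJ1, hJ2⟩ : ∃ J : ℕ, (J : ℝ) ≤ Real.log (32 * X ^ 4) / Real.log 2 + 1 ∧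
      32 * X ^ 4 ≤ 2 ^ J := by
    refine ⟨⌈Real.log (32 * X ^ 4) / Real.log 2⌉₊,
      (Nat.ceil_lt_add_one (div_nonneg (Real.log_nonneg h2X) hl2.le)).le, ?_⟩
    rw [← Real.log_le_log_iff (by linarith) (by positivity), Real.log_pow, ← div_le_iff₀ hl2]
    exact Nat.le_ceil _
  have hτ : P * M.basicDist s t / 2 ^ (J + 1) ≤ M.threshold s t ε ℓ := by
    have hlg : Real.log (2 * M.n) ≤ 2 * g := by
      rw [hg, Real.log_mul (by norm_num) (by positivity)]
      have := Real.log_le_log (by norm_num) (show (2 : ℝ) ≤ M.n by linarith)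
      linarith
    have hlg0 : 0 < Real.log (2 * M.n) := Real.log_pos (by linarith)
    have h1 : 32 * g * P ^ 4 * ℓ ≤ ε ^ 2 * 2 ^ J := by
      have h2 : g ≤ g ^ 4 := le_self_pow₀ hg1 (by norm_num)
      have h3 : (ℓ : ℝ) ≤ ℓ ^ 4 := le_self_pow₀ hℓ' (by norm_num)
      have h4 : ε ^ 8 ≤ ε ^ 2 := pow_le_pow_of_le_one hε.le hε1 (by norm_num)
      have h5 : X ^ 4 * ε ^ 8 = g ^ 4 * P ^ 4 * ℓ ^ 4 := by
        rw [hX]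
        field_simp
      calc 32 * g * P ^ 4 * ℓ ≤ 32 * g ^ 4 * P ^ 4 * ℓ ^ 4 := by gcongr
        _ = 32 * (X ^ 4 * ε ^ 8) := by rw [h5]; ring
        _ ≤ 32 * (X ^ 4 * ε ^ 2) := by gcongr
        _ = ε ^ 2 * (32 * X ^ 4) := by ring
        _ ≤ ε ^ 2 * 2 ^ J := by gcongr
    rw [threshold, rpow_three_mul, ← hP, div_le_div_iff₀ (by positivity) (by positivity)]
    calc P * M.basicDist s t * (16 * Real.log (2 * M.n) * P ^ 3 * ℓ)
        ≤ P * M.basicDist s t * (16 * (2 * g) * P ^ 3 * ℓ) := by gcongr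
      _ = M.basicDist s t * (32 * g * P ^ 4 * ℓ) := by ring
      _ ≤ M.basicDist s t * (ε ^ 2 * 2 ^ J) := by gcongr
      _ ≤ ε ^ 2 * M.basicDist s t * 2 ^ (J + 1) := by
          rw [pow_succ (2 : ℝ) J]
          have : 0 ≤ M.basicDist s t * (ε ^ 2 * 2 ^ J) := by positivity
          linarith
  have hR : 0 < P * M.basicDist s t := by positivity
  obtain ⟨h1, h2⟩ := hh.card_le hb hR (J := J) (hst.elim fun p => p.left_mem) (M.probed s t ε ℓ)
    M.cluster (fun i => Finset.univ.filter fun e => e ∈ E(M.searchGraph s t) ∧ e ∈ M.cluster i)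
    (fun i _ => hC i) (fun i _ e he => (Finset.mem_filter.1 he).2)
    (fun i hi => hτ.trans_lt (hprobed i hi)) hℓ
  exact natCast_le_rpow_of_le (Real.log_pos hl3)
    (Real.log_le_log (by linarith) (hg3.trans hgX)) hX0 (h2 hne) hℓ1 hℓX hJ1 h1

end DemandModel

end

theorem theorem4 :
    ∃ C : ℝ, 0 < C ∧
      ∀ (α β : Type*) [Fintype α] [Fintype β] (m : ℕ) (M : DemandModel α β m) (s t : α)
        (h ℓ : ℕ) (ε : ℝ),
        3 ≤ M.n → M.G.Reachable s t → 0 < ε → ε ≤ 1 → 1 ≤ ℓ →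
        M.G.HasContinuousHighwayDim M.basicWeight h →
        (∀ i, M.G.IsShortestPathEdgeSet M.basicWeight (M.cluster i)) →
        (∀ e ∈ E(M.G), {i | e ∈ M.cluster i}.ncard ≤ ℓ) →
        ((M.probed s t ε ℓ).card : ℝ) ≤
            (Real.log M.n * M.ρ ^ M.expo * ℓ / ε ^ 2) ^ (C * Real.log h) ∧
          (M.demandLaw.prod M.demandLaw)
              {yz | ¬ |M.output s t ε ℓ yz.1 yz.2 - M.G.wdist (M.weight yz.1) s t| ≤
                ε * M.G.wdist (M.weight yz.1) s t} ≤
            ENNReal.ofReal (1 / M.n) := by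
  -- `log (log 3)` is positive and, as `3 ≤ n`, bounds the logarithm of the base of the power from
  -- below.
  refine ⟨14 / Real.log (Real.log 3) + 14, ?_, ?_⟩
  · have := Real.log_pos one_lt_log_three
    positivity
  · intro α β _ _ m M s t h ℓ ε hn hst hε hε1 hℓ1 hh hC hℓ
    exact ⟨DemandModel.card_probed_le hn hst hε hε1 hℓ1 hh hC hℓ,
      DemandModel.measure_failure_le hn hst hε hℓ1 hℓ⟩
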